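/- All graphs are finite and simple. A graph $G$ with $n$ edges is \emph{graceful} if there is an injective map $f\colon V(G)\to\{0,1,\dots,n\}$ such that the set of induced edge labels $\{|f(u)-f(v)| : uv\in E(G)\}$ equals $\{1,\dots,n\}$. A \emph{generalized banana tree} is a tree obtained from a collection of stars $K_{1,m_i}$, $m_i\ge 1$, by joining a leaf of each star by a path of fixed length $h\ge 0$ to a new vertex, called the \emph{apex} (for $h=0$ the chosen leaves are all identified with the apex). A \emph{banana tree} is a generalized banana tree with $h=1$. Root a generalized banana tree at its apex; the level of a vertex is its distance from the apex, and the depth $d$ is the largest level. An \emph{even-caterpillar banana tree} is a tree obtained from a rooted generalized banana tree of depth $d$ by choosing an integer $k$ with $0\le k<d$ and, for each $l$ with $k\le l\le d-2$, attaching a positive even number of leaves to each vertex at level $l$ (the numbers may differ from vertex to vertex). A \emph{caterpillar} is a tree containing a path such that every vertex of the tree is at distance at most $1$ from the path. An \emph{arbitrarily fixed generalized banana tree} is a tree obtained from a collection of caterpillars, all of the same diameter $N$, by identifying a chosen vertex of maximum eccentricity of each caterpillar all together, where for some fixed even number $D$ every internal (that is, non-leaf) vertex of each caterpillar has degree $D$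 in that caterpillar, except possibly the internal vertices at distance $N-1$ from the chosen vertex. \textbf{Theorem.} Every even-caterpillar banana tree is graceful. Moreover, let $T$ be a tree with at least two vertices; if $T$ is a banana tree, a generalized banana tree, or an arbitrarily fixed generalized banana tree, then $T$ is an even-caterpillar banana tree. -/

import Mathlib

namespace GracefulTrees

/-- A graceful labeling of a graph `G` with `n` edges: an injective map `f` from the vertices to
the non-negative integers, with all labels in `{0, …, n}`, such that the set of induced edge
labels `|f u - f v|` is exactly `{1, …, n}`. -/
def IsGracefulLabeling {V : Type*} (G : SimpleGraph V) (f : V → ℕ) : Prop :=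
  Function.Injective f ∧
  (∀ v, f v ≤ G.edgeSet.ncard) ∧
  {e : ℕ | ∃ u v, G.Adj u v ∧ e = ((f u : ℤ) - (f v : ℤ)).natAbs} = Set.Icc 1 G.edgeSet.ncard

/-- A graph is graceful if it has a graceful labeling. -/
def IsGraceful {V : Type*} (G : SimpleGraph V) : Prop :=
  ∃ f : V → ℕ, IsGracefulLabeling G f

/-- Vertices of the generalized banana tree obtained from the stars `K_{1, s i}` (`i : Fin n`)
and the path length `h`.

In branch `i`, the path of length `h` from the apex to the chosen leaf of the `i`-th star runs
through `apex, spine i 0, …, spine i (h - 1)`, so that the chosen leaf is `spine i (h - 1)`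
(and it is the apex itself if `h = 0`). The center of the star is `spine i h`, and its
remaining `s i - 1` leaves are the vertices `tip i a`. -/
inductive BananaVertex {n : ℕ} (h : ℕ) (s : Fin n → ℕ) : Type
  | apex : BananaVertex h s
  | spine (i : Fin n) (j : Fin (h + 1)) : BananaVertex h s
  | tip (i : Fin n) (a : Fin (s i - 1)) : BananaVertex h s

/-- `IsParent x y`: the vertex `x` is the neighbour of `y` on the way to the apex. -/
def IsParent {n h : ℕ} {s : Fin n → ℕ} : BananaVertex h s → BananaVertex h s → Prop
  | .apex, .spine _ j => j.val = 0
  | .spine i j, .spine i' j' => i = i' ∧ j.val + 1 = j'.val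
  | .spine i j, .tip i' _ => i = i' ∧ j.val = h
  | _, _ => False

/-- The generalized banana tree obtained from the stars `K_{1, s i}` (each `s i ≥ 1`) by joining
a leaf of each star by a path of length `h` to a new vertex, the apex. -/
def bananaGraph {n : ℕ} (h : ℕ) (s : Fin n → ℕ) : SimpleGraph (BananaVertex h s) :=
  SimpleGraph.fromRel IsParent

/-- Generalized banana trees, up to isomorphism. -/
def IsGeneralizedBananaTree {V : Type*} (G : SimpleGraph V) : Prop :=
  ∃ (n h : ℕ) (s : Fin n → ℕ), (∀ i, 1 ≤ s i) ∧ Nonempty (G ≃g bananaGraph h s)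

/-- Banana trees, up to isomorphism: a leaf of each star is joined to the apex by an edge, that
is, by a path of length `1`. -/
def IsBananaTree {V : Type*} (G : SimpleGraph V) : Prop :=
  ∃ (n : ℕ) (s : Fin n → ℕ), (∀ i, 1 ≤ s i) ∧ Nonempty (G ≃g bananaGraph 1 s)

/-- The graph obtained from `G` by attaching `t v` new leaves to each vertex `v`. -/
def attachLeaves {V : Type*} (G : SimpleGraph V) (t : V → ℕ) :
    SimpleGraph (V ⊕ (Σ v : V, Fin (t v))) where
  Adj
    | .inl u, .inl v => G.Adj u v
    | .inl u, .inr x => u = x.1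
    | .inr x, .inl v => x.1 = v
    | .inr _, .inr _ => False
  symm := ⟨by
    rintro (u | x) (v | y) huv
    · exact SimpleGraph.Adj.symm huv
    · exact Eq.symm huv
    · exact Eq.symm huv
    · exact huv⟩
  loopless := ⟨by
    rintro (u | x) hu
    · exact SimpleGraph.irrefl G hu
    · exact hu⟩

/-- Even-caterpillar banana trees, up to isomorphism. Start with a generalized banana tree rooted
at its apex; its depth `d` is the largest distance from the apex to a vertex, and the level of a
vertex is its distance from the apex. Choose `k < d`, and attach a positive even number of leaves
(which may differ from vertex to vertex) to each vertex at a level `l` with `k ≤ l ≤ d - 2`,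
and no leaves to the other vertices. -/
def IsEvenCaterpillarBananaTree {V : Type*} (G : SimpleGraph V) : Prop :=
  ∃ (n h : ℕ) (s : Fin n → ℕ) (d k : ℕ) (t : BananaVertex h s → ℕ),
    (∀ i, 1 ≤ s i) ∧
    (bananaGraph h s).eccent .apex = (d : ℕ∞) ∧
    k < d ∧
    (∀ v, k ≤ (bananaGraph h s).dist .apex v → (bananaGraph h s).dist .apex v + 2 ≤ d →
      0 < t v ∧ Even (t v)) ∧
    (∀ v, ¬ (k ≤ (bananaGraph h s).dist .apex v ∧ (bananaGraph h s).dist .apex v + 2 ≤ d) →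
      t v = 0) ∧
    Nonempty (G ≃g attachLeaves (bananaGraph h s) t)

/-- A caterpillar is a tree with a path such that all vertices are at distance at most `1`
from the path. -/
def IsCaterpillar {V : Type*} (T : SimpleGraph V) : Prop :=
  T.IsTree ∧ ∃ (u v : V) (p : T.Walk u v), p.IsPath ∧ ∀ x, ∃ y ∈ p.support, T.dist x y ≤ 1

/-- The graph `G` is obtained from the graphs `C i` by identifying a chosen vertex of each `C i`
all together, the identified vertex being `r`. -/
def IsWedge {V ι : Type*} (G : SimpleGraph V) (r : V) (C : ι → G.Subgraph) : Prop :=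
  (∀ i, r ∈ (C i).verts) ∧
  (∀ i j, i ≠ j → (C i).verts ∩ (C j).verts = {r}) ∧
  (⨆ i, C i) = ⊤

/-- Arbitrarily fixed generalized banana trees: trees obtained from a collection of caterpillars
`C i`, all of the same diameter `N`, by identifying a chosen vertex of maximum eccentricity of each
of them all together (the vertex `r`), where all internal vertices of all the caterpillars have
the same even degree `D`, except possibly those at distance `N - 1` from the chosen vertex. -/
def IsArbitrarilyFixedGeneralizedBananaTree {V : Type*} (G : SimpleGraph V) : Prop :=
  ∃ (n : ℕ) (C : Fin n → G.Subgraph) (r : V) (N D : ℕ),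
    IsWedge G r C ∧ Even D ∧
    ∀ i, IsCaterpillar (C i).coe ∧
      (C i).coe.ediam = (N : ℕ∞) ∧
      ∀ c : (C i).verts, (c : V) = r →
        (∀ x, (C i).coe.eccent x ≤ (C i).coe.eccent c) ∧
        ∀ x, 2 ≤ ((C i).coe.neighborSet x).ncard → (C i).coe.dist c x + 1 ≠ N →
          ((C i).coe.neighborSet x).ncard = D

end GracefulTrees

namespace GracefulTrees

/-! Gracefulness is proved by a transfer argument. Let m be the number of edges and v 0, v 1, … the
zigzag 0, m, 1, m - 1, …. Hanging the labels 1, …, m on v 0 = 0 gives a star that realizes every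
difference. If a set of labels hanging on v j is symmetric under a ↦ v j + v (j + 1) - a, moving it
to v (j + 1) keeps its set of differences. So for a nested sequence S 0 = {1, …, m} ⊇ S 1 ⊇ … ⊇ S N
= ∅ of suitably symmetric sets, leaving S j \ S (j + 1) at v j still realizes everything
(`exists_abs_sub_eq_of_transfer`).

An even-caterpillar banana tree is a spider: legs of equal length from the apex, with leaves hung on
this body. Let the number n of legs be odd. Number the body level by level, so that q j is a child
of q (j - n), and label q j by v j. It remains to find S j of the right size with v (j + n) ∈ S j \
S (j + 1), and v 1, …, v n in S 0 \ S 1; the other labels in S j \ S (j + 1) go to the leaves at q j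
in any order. The centre of symmetry alternates between m/2 and (m + 1)/2, so a symmetric interval
can shrink by any odd number. Below the leg ends each vertex keeps an odd number of labels: an even
number of leaves and one body child, or n of them at the apex. Since v (j + n) lies far from the
centre, labels on both flanks are reserved for the body as soon as leaves appear (`remaining`). The
legs are sorted by their ends: odd numbers of leaves first, then positive even numbers, handled by
two symmetric arms, then zeros (`gracefulOn_of_odd`).

For even n, one leg is removed and the rest is labelled with 0 at the apex. The removed leg is a
caterpillar and is glued back vertex by vertex: a new neighbour of the vertex labelled 0 takes the
next free label, and complementing all labels moves the 0 to it (`GracefulOn.insert_leaf`).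

For the inclusions, generalized banana trees need no attached leaves. For the arbitrarily fixed
ones, r is an end of a longest path in each caterpillar, and all other vertices hang directly on
internal vertices of that path (`IsCaterpillar.exists_spine`). The paths form the legs, and the
common degree D gives D - 2 leaves per vertex. -/

/-- If `S N = ∅` and each `S (j + 1)` is symmetric under `a ↦ v j + v (j + 1) - a`,
then each difference between `v 0` and `S 0` occurs between some `v j` and `S j \ S (j + 1)`. -/
theorem exists_abs_sub_eq_of_transfer {S : ℕ → Finset ℤ} {v : ℕ → ℤ} {N : ℕ}
    (hsym : ∀ j < N, ∀ a ∈ S (j + 1), v j + v (j + 1) - a ∈ S (j + 1))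
    (hN : S N = ∅) {e a : ℤ} (ha : a ∈ S 0) (he : |v 0 - a| = e) :
    ∃ j < N, ∃ a ∈ S j \ S (j + 1), |v j - a| = e := by
  by_contra! hcon
  have key : ∀ j ≤ N, ∃ a ∈ S j, |v j - a| = e := by
    intro j
    induction j with
    | zero => exact fun _ => ⟨a, ha, he⟩
    | succ j ih =>
      intro hj
      obtain ⟨a, ha, he⟩ := ih (by omega)
      have h1 : a ∈ S (j + 1) := by
        by_contra h
        exact hcon j (by omega) a (Finset.mem_sdiff.2 ⟨ha, h⟩) he
      refine ⟨_, hsym j (by omega) a h1, ?_⟩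
      rw [← he, abs_sub_comm (v j) a]
      congr 1
      ring
  obtain ⟨a, ha, -⟩ := key N le_rfl
  simp [hN] at ha

/-! ### Label sets of the transfer process -/

/-- The integers `a` with `|2 a - σ| ≤ X`, when `X` and `σ` have the same parity. -/
noncomputable def ball (σ X : ℤ) : Finset ℤ := Finset.Icc ((σ - X) / 2) ((σ + X) / 2)

/-- The integers `a` with `Y ≤ |2 a - σ| ≤ Z`, when `Y`, `Z` and `σ` have the same parity. -/
noncomputable def sides (σ Y Z : ℤ) : Finset ℤ :=
  Finset.Icc ((σ + Y) / 2) ((σ + Z) / 2) ∪ Finset.Icc ((σ - Z) / 2) ((σ - Y) / 2)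

theorem mem_ball {σ X a : ℤ} (h : (σ - X) % 2 = 0) :
    a ∈ ball σ X ↔ -X ≤ 2 * a - σ ∧ 2 * a - σ ≤ X := by
  simp only [ball, Finset.mem_Icc]
  omega

theorem mem_sides {σ Y Z a : ℤ} (hY : (σ - Y) % 2 = 0) (hZ : (σ - Z) % 2 = 0) :
    a ∈ sides σ Y Z ↔
      (Y ≤ 2 * a - σ ∧ 2 * a - σ ≤ Z) ∨ (Y ≤ σ - 2 * a ∧ σ - 2 * a ≤ Z) := by
  simp only [sides, Finset.mem_union, Finset.mem_Icc]
  omega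

theorem card_ball {σ X : ℤ} (h : (σ - X) % 2 = 0) (hX : -1 ≤ X) :
    ((ball σ X).card : ℤ) = X + 1 := by
  simp only [ball, Int.card_Icc]
  omega

theorem card_sides {σ Y Z : ℤ} (hY : (σ - Y) % 2 = 0) (hZ : (σ - Z) % 2 = 0)
    (h : 1 ≤ Y ∧ Y ≤ Z + 2 ∨ Y = Z + 2) : ((sides σ Y Z).card : ℤ) = Z - Y + 2 := by
  rw [sides, Finset.card_union_of_disjoint]
  · push_cast
    simp only [Int.card_Icc]
    omega
  · rw [Finset.disjoint_left]
    intro a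
    simp only [Finset.mem_Icc]
    omega

/-- The centre of symmetry (doubled) of the set of labels remaining at step `j`. -/
def centre (m j : ℕ) : ℤ := m + 1 - ((j % 2 : ℕ) : ℤ)

/-- The zigzag sequence `0, m, 1, m - 1, …`. -/
def zigzag (m j : ℕ) : ℤ := if j % 2 = 0 then ((j / 2 : ℕ) : ℤ) else m - ((j / 2 : ℕ) : ℤ)

theorem zigzag_add_zigzag_succ (m j : ℕ) :
    zigzag m j + zigzag m (j + 1) = centre m (j + 1) := by
  simp only [zigzag, centre]
  split_ifs <;> omega

theorem zigzag_injOn {m : ℕ} : Set.InjOn (zigzag m) (Set.Iic m) := by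
  intro i hi j hj
  simp only [Set.mem_Iic, zigzag] at hi hj ⊢
  split_ifs <;> omega

theorem zigzag_mem {m j : ℕ} (h : j ≤ m) (hj : 0 < j) : 1 ≤ zigzag m j ∧ zigzag m j ≤ m := by
  simp only [zigzag]
  split_ifs <;> omega

/-- The data of a transfer process on a spider: `R j` counts the labels that remain at step `j`,
`c j` the leaves at step `j`. Steps from `a` to `b` carry positive even numbers of leaves, steps
from `b` to `d` odd numbers, and steps from `d` to `N` even numbers, the zeros coming last. -/
structure TransferData (n N m a b d : ℕ) (c : ℕ → ℕ) (R : ℕ → ℤ) : Prop where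
  odd : n % 2 = 1
  one_le : 1 ≤ a
  le_b : a ≤ b
  le_d : b ≤ d
  le_N : d ≤ N
  N_eq : N = b + n
  R_zero : R 0 = m
  R_one : R 0 = R 1 + n + c 0
  R_succ : ∀ j, 1 ≤ j → j < b → R j = R (j + 1) + 1 + c j
  R_succ' : ∀ j, b ≤ j → j < N → R j = R (j + 1) + c j
  R_N : R N = 0
  c_zero : c 0 % 2 = 0
  start : a = 1 ∨ c 0 = 0
  c_init : ∀ j, 1 ≤ j → j < a → c j = 0
  c_mid : ∀ j, a ≤ j → j < b → 0 < c j ∧ c j % 2 = 0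
  c_odd : ∀ j, b ≤ j → j < d → c j % 2 = 1
  c_even : ∀ j, d ≤ j → j < N → c j % 2 = 0
  c_last : ∀ j, d ≤ j → j + 1 < N → c j = 0 → c (j + 1) = 0

namespace TransferData

variable {n N m a b d : ℕ} {c : ℕ → ℕ} {R : ℕ → ℤ}

theorem R_nonneg (D : TransferData n N m a b d c R) (j : ℕ) (hj : j ≤ N) : 0 ≤ R j := by
  induction hj using Nat.decreasingInduction with
  | self => exact D.R_N.ge
  | of_succ j hj ih =>
    have h0 := D.R_one
    have h1 := D.R_succ j
    have h2 := D.R_succ' j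
    rcases Nat.eq_zero_or_pos j with rfl | h
    · simp only [zero_add] at *; omega
    · omega

/-- Each step before `b` uses at least the label of one body child. This bound keeps the central
interval away from the reserved flanks. -/
theorem R_le (D : TransferData n N m a b d c R) (j : ℕ) (h1 : 1 ≤ j) (hb : j ≤ b) :
    R j ≤ m - n - j + 1 := by
  induction j, h1 using Nat.le_induction with
  | base => have := D.R_one; have := D.R_zero; omega
  | succ j h1 ih => have := D.R_succ j h1 (by omega); have := ih (by omega); push_cast; omega

theorem R_init (D : TransferData n N m a b d c R) (j : ℕ) (h1 : 1 ≤ j) (ha : j < a) :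
    R j = m - n - j + 1 := by
  induction j, h1 using Nat.le_induction with
  | base => have := D.R_one; have := D.R_zero; have := D.start; omega
  | succ j h1 ih =>
    have := D.le_b
    have := D.R_succ j h1 (by omega); have := ih (by omega); have := D.c_init j h1 (by omega)
    push_cast; omega

/-- Each of these steps uses one body label and at least two leaf labels. Hence 2 (b - j) labels can
be reserved on the flanks. -/
theorem R_mid (D : TransferData n N m a b d c R) (j : ℕ) (ha : a ≤ j) (hb : j ≤ b) :
    R b + 3 * (b - j) ≤ R j := by
  induction hb using Nat.decreasingInduction with
  | self => simp
  | of_succ j hj ih =>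
    have := D.one_le
    have := D.R_succ j (by omega) (by omega); have := ih (by omega); have := D.c_mid j ha (by omega)
    omega

/-- An odd number of labels is kept at every step before `d`, while the doubled centre also changes
parity at every step. -/
theorem R_parity (D : TransferData n N m a b d c R) (j : ℕ) (hj : j ≤ d) :
    (centre m j - (R j - 1)) % 2 = 0 := by
  induction j with
  | zero => have := D.R_zero; simp only [centre]; omega
  | succ j ih =>
    have := ih (by omega)
    have h0 := D.R_one
    have h1 := D.R_succ j
    have h2 := D.R_succ' j
    have h3 := D.odd
    have h4 := D.c_zero
    have h5 := D.c_init j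
    have h6 := D.c_mid j
    have h7 := D.c_odd j
    have h8 := D.le_N
    have h9 := D.le_b
    have h10 := D.one_le
    simp only [centre] at *
    rcases Nat.eq_zero_or_pos j with rfl | h
    · simp only [zero_add] at *; omega
    · omega

theorem R_even (D : TransferData n N m a b d c R) (j : ℕ) (hd : d ≤ j) (hj : j ≤ N) :
    R j % 2 = 0 := by
  induction hj using Nat.decreasingInduction with
  | self => simp [D.R_N]
  | of_succ j hj ih =>
    have := D.le_d
    have := D.R_succ' j (by omega) hj
    have := D.c_even j hd hj
    omega

theorem R_last (D : TransferData n N m a b d c R) (j : ℕ) (hd : d ≤ j) (hj : j < N)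
    (h : c j = 0) : R j = 0 := by
  obtain ⟨k, rfl⟩ : ∃ k, N = k + 1 := ⟨N - 1, by omega⟩
  have hjk : j ≤ k := by omega
  clear hj
  induction hjk using Nat.decreasingInduction with
  | self => have := D.le_d; have := D.R_succ' k (by omega) (by omega); have := D.R_N; omega
  | of_succ j hj ih =>
    have := D.le_d
    have := D.R_succ' j (by omega) (by omega)
    have := ih (by omega) (D.c_last j hd (by omega) h)
    omega

/-- As long as labels remain, every step past `d` uses at least two of them. This keeps the inner
radius of the two arms positive, so that the arms stay disjoint. -/
theorem R_tail (D : TransferData n N m a b d c R) (j : ℕ) (hd : d ≤ j) (hj : j ≤ N) :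
    R j = 0 ∨ 2 * ((j : ℤ) - d) ≤ R d - R j := by
  induction j, hd using Nat.le_induction with
  | base => right; omega
  | succ j h1 ih =>
    have := D.le_d
    have h2 := D.R_last j h1 (by omega)
    have h3 := D.R_succ' j (by omega) (by omega)
    have h4 := D.R_nonneg (j + 1) hj
    have h5 := ih (by omega)
    have h6 := D.c_even j h1 (by omega)
    push_cast
    omega

end TransferData

/-- The labels that remain at step `j` of the transfer process. -/
noncomputable def remaining (n m a b d : ℕ) (R : ℕ → ℤ) (j : ℕ) : Finset ℤ :=
  if j < a then ball (centre m j) (R j - 1)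
  -- The flanks hold b - j labels on each side. Each step takes the outermost label of one side,
  -- which is the next body label, and the innermost label of the other side, which goes to a leaf;
  -- the central interval supplies the other c j - 1.
  else if j < b then ball (centre m j) (R j - 1 - 2 * (b - j)) ∪
    sides (centre m j) (m - n - 2 * b + j + 2) (m - n - j)
  else if j < d then ball (centre m j) (R j - 1)
  -- Two arms with R j / 2 labels each. At j = d the inner radius is 1, so the arms form the
  -- interval of R d labels. Each step lowers the outer radius by one.
  else sides (centre m j) (R d + 1 - (j - d) - R j) (R d - 1 - (j - d))

namespace TransferData

variable {n N m a b d : ℕ} {c : ℕ → ℕ} {R : ℕ → ℤ}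

/-- With membership written as inequalities on 2 x - `centre m j`, the symmetry, nesting and zigzag
statements become linear arithmetic. -/
theorem mem_remaining (D : TransferData n N m a b d c R) {j : ℕ} (hj : j ≤ N) {x : ℤ} :
    x ∈ remaining n m a b d R j ↔
      (j < a ∨ b ≤ j ∧ j < d) ∧ -(R j - 1) ≤ 2 * x - centre m j ∧ 2 * x - centre m j ≤ R j - 1 ∨
      (a ≤ j ∧ j < b) ∧
        (-(R j - 1 - 2 * (b - j)) ≤ 2 * x - centre m j ∧
          2 * x - centre m j ≤ R j - 1 - 2 * (b - j) ∨
        ((m - n - 2 * b + j + 2 : ℤ) ≤ 2 * x - centre m j ∧ 2 * x - centre m j ≤ m - n - j ∨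
        (m - n - 2 * b + j + 2 : ℤ) ≤ centre m j - 2 * x ∧ centre m j - 2 * x ≤ m - n - j)) ∨
      d ≤ j ∧
        (R d + 1 - (j - d) - R j ≤ 2 * x - centre m j ∧
          2 * x - centre m j ≤ R d - 1 - (j - d) ∨
        R d + 1 - (j - d) - R j ≤ centre m j - 2 * x ∧
          centre m j - 2 * x ≤ R d - 1 - (j - d)) := by
  have h1 := D.R_parity j
  have h2 := D.R_parity d le_rfl
  have h3 := D.R_even j
  have h4 := D.le_b
  have h5 := D.le_d
  have h6 := D.odd
  have h7 := D.R_even d le_rfl D.le_N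
  have h8 : (centre m j - (m - n - j)) % 2 = 0 := by simp only [centre]; omega
  have h9 : (centre m j - centre m d - (j - d)) % 2 = 0 := by simp only [centre]; omega
  unfold remaining
  split_ifs with ha hb hd
  · rw [mem_ball (h1 (by omega))]; omega
  · rw [Finset.mem_union, mem_ball (by have := h1 (by omega); omega),
      mem_sides (by omega) (by omega)]
    omega
  · rw [mem_ball (h1 (by omega))]; omega
  · rw [mem_sides (by have := h3 (by omega) hj; omega) (by omega)]; omega

theorem remaining_zero (D : TransferData n N m a b d c R) :
    remaining n m a b d R 0 = Finset.Icc 1 (m : ℤ) := by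
  ext x
  have := D.one_le
  have := D.le_b
  have := D.le_d
  rw [D.mem_remaining (Nat.zero_le _), Finset.mem_Icc, D.R_zero]
  simp only [centre]
  omega

theorem remaining_N (D : TransferData n N m a b d c R) : remaining n m a b d R N = ∅ := by
  ext x
  have := D.one_le
  have := D.le_b
  have := D.le_d
  have := D.le_N
  have := D.N_eq
  have := D.odd
  rw [D.mem_remaining le_rfl, D.R_N]
  simp only [Finset.notMem_empty, iff_false]
  omega

theorem remaining_symm (D : TransferData n N m a b d c R) {j : ℕ} (hj : j ≤ N) {x : ℤ}
    (hx : x ∈ remaining n m a b d R j) : centre m j - x ∈ remaining n m a b d R j := by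
  rw [D.mem_remaining hj] at hx ⊢
  omega

theorem centre_succ (m j : ℕ) :
    centre m (j + 1) = centre m j + 1 ∨ centre m (j + 1) = centre m j - 1 := by
  simp only [centre]
  omega

theorem remaining_one_subset (D : TransferData n N m a b d c R) :
    remaining n m a b d R 1 ⊆ remaining n m a b d R 0 := by
  intro x hx
  have h1 := D.one_le
  have h2 := D.le_b
  have h3 := D.le_d
  have h4 := D.le_N
  rw [D.mem_remaining (by omega)] at hx
  rw [D.mem_remaining (Nat.zero_le _), D.R_zero]
  have h5 := D.R_le 1 le_rfl (by omega)
  have h6 := centre_succ m 0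
  have h7 := D.odd
  have h8 := D.R_mid 1
  have h9 := D.R_nonneg b (by omega)
  have h10 : d = 1 → R d = R 1 := by rintro rfl; rfl
  simp only [zero_add] at *
  omega

/-- The doubled centre moves by one, so nesting needs each doubled radius to drop by at least one.
For the central interval between `a` and `b` the drop is c j - 1, which is where positivity of c j
enters. -/
theorem remaining_succ_subset_of_lt (D : TransferData n N m a b d c R) {j : ℕ} (hj : j < N)
    (h0 : 0 < j) (hd : j < d) :
    remaining n m a b d R (j + 1) ⊆ remaining n m a b d R j := by
  intro x hx
  have h1 := D.one_le
  have h2 := D.le_b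
  have h3 := D.le_d
  have h4 := D.le_N
  rw [D.mem_remaining (show j + 1 ≤ N by omega)] at hx
  rw [D.mem_remaining hj.le]
  have h5 := D.R_le (j + 1)
  have h6 := centre_succ m j
  have h9 := D.R_nonneg b (by omega)
  have h10 : d = j + 1 → R d = R (j + 1) := by rintro rfl; rfl
  rcases lt_or_ge j b with hb | hb
  · have h11 := D.R_succ j h0 hb
    rcases lt_or_ge j a with ha | ha
    · have h12 := D.R_init j h0 ha
      have h8 := D.R_mid (j + 1)
      have h13 : (j < a ∨ b ≤ j ∧ j < d) := Or.inl ha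
      left
      refine ⟨h13, ?_⟩
      omega
    · have h12 := D.c_mid j ha hb
      right
      left
      refine ⟨⟨ha, hb⟩, ?_⟩
      omega
  · have h11 := D.R_succ' j hb hj
    have h12 := D.c_odd j hb hd
    left
    refine ⟨Or.inr ⟨hb, hd⟩, ?_⟩
    omega

/-- The outer radius drops by one and the inner one grows by c j - 1, against a shift of the centre
by one. For c j = 0 nesting would fail for a nonempty set, but then nothing remains by `R_last`. -/
theorem remaining_succ_subset_of_ge (D : TransferData n N m a b d c R) {j : ℕ} (hj : j < N)
    (hd : d ≤ j) :
    remaining n m a b d R (j + 1) ⊆ remaining n m a b d R j := by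
  intro x hx
  have h1 := D.one_le
  have h2 := D.le_b
  have h3 := D.le_d
  rw [D.mem_remaining (show j + 1 ≤ N by omega)] at hx
  rw [D.mem_remaining hj.le]
  have h4 := D.R_succ' j (by omega) hj
  have h5 := D.c_even j hd hj
  have h6 := D.R_last j hd hj
  have h7 := D.R_nonneg (j + 1) hj
  have h8 := centre_succ m j
  replace hx := hx.resolve_left (by omega)
  replace hx := hx.resolve_left (by omega)
  right
  right
  omega

theorem remaining_succ_subset (D : TransferData n N m a b d c R) {j : ℕ} (hj : j < N) :
    remaining n m a b d R (j + 1) ⊆ remaining n m a b d R j := by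
  rcases Nat.eq_zero_or_pos j with rfl | h0
  · exact D.remaining_one_subset
  rcases lt_or_ge j d with hd | hd
  · exact D.remaining_succ_subset_of_lt hj h0 hd
  · exact D.remaining_succ_subset_of_ge hj hd

theorem card_remaining (D : TransferData n N m a b d c R) {j : ℕ} (hj : j ≤ N) :
    ((remaining n m a b d R j).card : ℤ) = R j := by
  have h1 := D.R_parity j
  have h2 := D.R_parity d le_rfl
  have h3 := D.R_even j
  have h4 := D.le_b
  have h5 := D.le_d
  have h6 := D.odd
  have h7 := D.R_even d le_rfl D.le_N
  have h8 : (centre m j - (m - n - j)) % 2 = 0 := by simp only [centre]; omega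
  have h9 : (centre m j - centre m d - (j - d)) % 2 = 0 := by simp only [centre]; omega
  have h10 := D.R_nonneg j hj
  have h11 := D.R_mid j
  have h12 := D.R_nonneg b (D.le_d.trans D.le_N)
  have h13 := D.R_le j
  have h14 := D.R_tail j
  have h15 := D.one_le
  unfold remaining
  split_ifs with ha hb hd
  · rw [card_ball (h1 (by omega)) (by omega)]; ring
  · rw [Finset.card_union_of_disjoint, Nat.cast_add,
      card_ball (by have := h1 (by omega); omega) (by omega),
      card_sides (by omega) (by omega) (by omega)]
    · ring
    · rw [Finset.disjoint_left]
      intro x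
      rw [mem_ball (by have := h1 (by omega); omega), mem_sides (by omega) (by omega)]
      omega
  · rw [card_ball (h1 (by omega)) (by omega)]; ring
  · rw [card_sides (by have := h3 (by omega) hj; omega) (by omega) (by omega)]
    ring

/-- As n is odd, i and j = i - n have opposite parity. For i > n the doubled distance of v i from
the centre at step j is then exactly m - n - j, the outermost one present; the centre next moves
away from v i, which drops out. The indices i ≤ n all belong to step 0 by truncated subtraction. -/
theorem zigzag_mem_remaining (D : TransferData n N m a b d c R) {i : ℕ} (h0 : 0 < i)
    (hi : i < N) :
    zigzag m i ∈ remaining n m a b d R (i - n) \ remaining n m a b d R (i - n + 1) := by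
  have hN := D.N_eq
  have hn := D.odd
  have h4 := D.le_b
  have h5 := D.le_d
  have h6 := D.one_le
  have h7 := D.le_N
  rcases le_or_gt i n with hin | hin
  · rw [Nat.sub_eq_zero_of_le hin, Finset.mem_sdiff, D.mem_remaining (Nat.zero_le _),
      D.mem_remaining (by omega)]
    have := D.R_zero
    have := D.R_one
    have := D.R_le 1 le_rfl (by omega)
    have := D.R_nonneg 1 (by omega)
    have := D.R_nonneg b (by omega)
    have := D.R_mid 1
    have : d = 1 → R d = R 1 := by rintro rfl; rfl
    have := D.R_le b (by omega) (by omega)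
    simp only [zigzag, centre, zero_add]
    split_ifs <;> omega
  · obtain ⟨j, rfl⟩ : ∃ j, i = j + n := ⟨i - n, by omega⟩
    rw [Nat.add_sub_cancel, Finset.mem_sdiff, D.mem_remaining (by omega),
      D.mem_remaining (by omega)]
    have := D.R_le (j + 1) (by omega) (by omega)
    have := D.R_le b (by omega) (by omega)
    have : d = j + 1 → R d = R (j + 1) := by rintro rfl; rfl
    have := D.R_init j
    have := D.R_nonneg (j + 1) (by omega)
    have := D.R_nonneg b (by omega)
    have := D.R_le j (by omega) (by omega)
    simp only [zigzag, centre]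
    split_ifs <;> omega

end TransferData

/-! ### From label sets to labellings -/

/-- Bijections between blocks of equal size are glued. Which leaf of a vertex receives which label
is irrelevant, so only the sizes of the blocks matter. -/
theorem exists_injOn_image_eq {ι α β : Type*} [DecidableEq α] [DecidableEq β] [Nonempty β]
    (s : Finset ι) (P : ι → Finset α) (Q : ι → Finset β)
    (hP : ∀ i ∈ s, ∀ j ∈ s, i ≠ j → Disjoint (P i) (P j))
    (hQ : ∀ i ∈ s, ∀ j ∈ s, i ≠ j → Disjoint (Q i) (Q j))
    (hc : ∀ i ∈ s, (P i).card = (Q i).card) :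
    ∃ f : α → β, Set.InjOn f {x | ∃ i ∈ s, x ∈ P i} ∧ ∀ i ∈ s, (P i).image f = Q i := by
  classical
  have h1 : ∀ i, ∃ g : α → β, i ∈ s → Set.InjOn g (P i) ∧ (P i).image g = Q i := by
    intro i
    by_cases hi : i ∈ s
    · obtain ⟨e⟩ : Nonempty (P i ≃ Q i) := ⟨Finset.equivOfCardEq (hc i hi)⟩
      refine ⟨fun x => if h : x ∈ P i then e ⟨x, h⟩ else Classical.arbitrary β, fun _ => ⟨?_, ?_⟩⟩
      · intro x hx y hy hxy
        have hx' : x ∈ P i := hx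
        have hy' : y ∈ P i := hy
        simp only [hx', hy', dif_pos] at hxy
        simpa using e.injective (Subtype.ext hxy)
      · ext y
        simp only [Finset.mem_image]
        constructor
        · rintro ⟨x, hx, rfl⟩
          simp [hx]
        · intro hy
          refine ⟨e.symm ⟨y, hy⟩, (e.symm ⟨y, hy⟩).2, ?_⟩
          simp
    · exact ⟨fun _ => Classical.arbitrary β, fun h => absurd h hi⟩
  choose g hg using h1
  let f : α → β := fun x =>
    if h : ∃ i ∈ s, x ∈ P i then g h.choose x else Classical.arbitrary β
  have hf : ∀ i ∈ s, ∀ x ∈ P i, f x = g i x := by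
    intro i hi x hx
    have h : ∃ i ∈ s, x ∈ P i := ⟨i, hi, hx⟩
    have h2 : h.choose = i := by
      by_contra hne
      exact Finset.disjoint_left.1 (hP _ h.choose_spec.1 _ hi hne) h.choose_spec.2 hx
    simp only [f, dif_pos h, h2]
  have him : ∀ i ∈ s, (P i).image f = Q i := by
    intro i hi
    rw [← (hg i hi).2]
    exact Finset.image_congr fun x hx => hf i hi x hx
  refine ⟨f, ?_, him⟩
  rintro x ⟨i, hi, hx⟩ y ⟨j, hj, hy⟩ hxy
  by_cases hij : i = j
  · subst hij
    rw [hf i hi x hx, hf i hi y hy] at hxy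
    exact (hg i hi).1 hx hy hxy
  · have h1 : f x ∈ Q i := him i hi ▸ Finset.mem_image_of_mem f hx
    have h2 : f y ∈ Q j := him j hj ▸ Finset.mem_image_of_mem f hy
    exact absurd (hxy ▸ h2) (Finset.disjoint_left.1 (hQ i hi j hj hij) h1)

/-- The vertices in `A` can be labelled by `0, …, #A - 1`, with the label `0` at `x`, so that all
differences `1, …, #A - 1` occur along edges of `G`. -/
def GracefulOn {V : Type*} (G : SimpleGraph V) (A : Finset V) (x : V) : Prop :=
  ∃ f : V → ℤ, Set.InjOn f A ∧ (∀ v ∈ A, 0 ≤ f v ∧ f v < A.card) ∧ f x = 0 ∧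
    ∀ e : ℤ, 0 < e → e < A.card → ∃ u ∈ A, ∃ v ∈ A, G.Adj u v ∧ |f u - f v| = e

theorem GracefulOn.compl {V : Type*} {G : SimpleGraph V} {A : Finset V} {y : V} {f : V → ℤ}
    (hinj : Set.InjOn f A) (hrange : ∀ v ∈ A, 0 ≤ f v ∧ f v < A.card)
    (hy : f y = A.card - 1)
    (hcover : ∀ e : ℤ, 0 < e → e < A.card → ∃ u ∈ A, ∃ v ∈ A, G.Adj u v ∧ |f u - f v| = e) :
    GracefulOn G A y := by
  refine ⟨fun v => A.card - 1 - f v, ?_, ?_, by simp [hy], ?_⟩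
  · intro u hu v hv huv
    exact hinj hu hv (by simp only at huv; omega)
  · intro v hv
    have := hrange v hv
    simp only
    omega
  · intro e he0 he
    obtain ⟨u, hu, v, hv, huv, hd⟩ := hcover e he0 he
    refine ⟨u, hu, v, hv, huv, ?_⟩
    rw [← hd, abs_sub_comm]
    congr 1
    ring

/-- The new vertex takes the label `A.card`, and its edge to the vertex labelled 0 supplies the one
missing difference. Complementing all labels then moves the 0 to the new vertex. -/
theorem GracefulOn.insert_leaf {V : Type*} [DecidableEq V] {G : SimpleGraph V} {A : Finset V}
    {x y : V} (h : GracefulOn G A x) (hx : x ∈ A) (hy : y ∉ A) (hxy : G.Adj x y) :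
    GracefulOn G (insert y A) x ∧ GracefulOn G (insert y A) y := by
  obtain ⟨f, hinj, hrange, hx0, hcover⟩ := h
  have hne : ∀ v ∈ A, v ≠ y := fun v hv h => hy (h ▸ hv)
  have hup : ∀ v ∈ A, Function.update f y A.card v = f v :=
    fun v hv => Function.update_of_ne (hne v hv) _ _
  suffices h : Set.InjOn (Function.update f y (A.card : ℤ)) (insert y A : Finset V) ∧
      (∀ v ∈ insert y A, 0 ≤ Function.update f y (A.card : ℤ) v ∧
        Function.update f y (A.card : ℤ) v < (insert y A).card) ∧
      ∀ e : ℤ, 0 < e → e < (insert y A).card → ∃ u ∈ insert y A, ∃ v ∈ insert y A, G.Adj u v ∧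
        |Function.update f y (A.card : ℤ) u - Function.update f y (A.card : ℤ) v| = e by
    refine ⟨⟨_, h.1, h.2.1, by rw [hup x hx, hx0], h.2.2⟩, GracefulOn.compl h.1 h.2.1 ?_ h.2.2⟩
    rw [Function.update_self, Finset.card_insert_of_notMem hy]
    push_cast
    ring
  refine ⟨?_, ?_, ?_⟩
  · rw [Finset.coe_insert, Set.injOn_insert (by simpa using hy)]
    constructor
    · intro u hu v hv huv
      rw [hup u hu, hup v hv] at huv
      exact hinj hu hv huv
    · rintro ⟨v, hv, hvy⟩
      rw [hup v hv, Function.update_self] at hvy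
      exact absurd (hrange v hv).2 (by omega)
  · intro v hv
    rw [Finset.card_insert_of_notMem hy]
    push_cast
    rcases Finset.mem_insert.1 hv with rfl | hv
    · rw [Function.update_self]; omega
    · rw [hup v hv]; have := hrange v hv; omega
  · intro e he0 he
    rw [Finset.card_insert_of_notMem hy] at he
    push_cast at he
    rcases lt_or_ge e A.card with h | h
    · obtain ⟨u, hu, v, hv, huv, hd⟩ := hcover e he0 h
      exact ⟨u, Finset.mem_insert_of_mem hu, v, Finset.mem_insert_of_mem hv, huv, by
        rw [hup u hu, hup v hv, hd]⟩
    · refine ⟨x, Finset.mem_insert_of_mem hx, y, Finset.mem_insert_self _ _, hxy, ?_⟩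
      rw [hup x hx, Function.update_self, hx0, zero_sub, abs_neg, abs_of_nonneg (by omega)]
      omega

/-- A spider with an odd number `n` of legs, whose body vertices are numbered `q 0, q 1, …` level
by level, so that `q j` is joined to `q (j - n)`, and with the set `Λ j` of leaves attached to
`q j`. -/
theorem gracefulOn_of_odd {V : Type*} [DecidableEq V] {G : SimpleGraph V} {n N a b d : ℕ}
    {q : ℕ → V} {Λ : ℕ → Finset V} (odd : n % 2 = 1) (one_le : 1 ≤ a) (le_b : a ≤ b) (le_d : b ≤ d)
    (le_N : d ≤ N) (N_eq : N = b + n)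
    (hq : ∀ i < N, ∀ j < N, q i = q j → i = j)
    (hΛ : ∀ i < N, ∀ j < N, i ≠ j → Disjoint (Λ i) (Λ j))
    (hqΛ : ∀ i < N, ∀ j < N, q i ∉ Λ j)
    (hadj : ∀ j, 0 < j → j < N → G.Adj (q (j - n)) (q j))
    (hadj' : ∀ j < N, ∀ x ∈ Λ j, G.Adj (q j) x)
    (c_zero : (Λ 0).card % 2 = 0)
    (start : a = 1 ∨ (Λ 0).card = 0)
    (c_init : ∀ j, 1 ≤ j → j < a → (Λ j).card = 0)
    (c_mid : ∀ j, a ≤ j → j < b → 0 < (Λ j).card ∧ (Λ j).card % 2 = 0)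
    (c_odd : ∀ j, b ≤ j → j < d → (Λ j).card % 2 = 1)
    (c_even : ∀ j, d ≤ j → j < N → (Λ j).card % 2 = 0)
    (c_last : ∀ j, d ≤ j → j + 1 < N → (Λ j).card = 0 → (Λ (j + 1)).card = 0) :
    GracefulOn G ((Finset.range N).biUnion fun j => insert (q j) (Λ j)) (q 0) := by
  -- The number of edges: one for each body vertex other than the root, and one for each leaf.
  set m : ℕ := N - 1 + ∑ j ∈ Finset.range N, (Λ j).card with hm
  -- The labels still needed from step j on: all later leaves, and the body vertices whose parent
  -- has index at least j. For j ≥ 1 these are q (j + n), …, q (N - 1), none once j ≥ b; for j = 0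
  -- they are the N - 1 body vertices other than the root.
  set R : ℕ → ℤ := fun j => ∑ i ∈ Finset.Ico j N, ((Λ i).card : ℤ) +
    if j = 0 then (n : ℤ) + b - 1 else ((b - j : ℕ) : ℤ) with hR
  have hIco : ∀ j < N, ∑ i ∈ Finset.Ico j N, ((Λ i).card : ℤ) =
      (Λ j).card + ∑ i ∈ Finset.Ico (j + 1) N, ((Λ i).card : ℤ) :=
    fun j hj => Finset.sum_eq_sum_Ico_succ_bot hj _
  have D : TransferData n N m a b d (fun j => (Λ j).card) R := by
    refine ⟨odd, one_le, le_b, le_d, le_N, N_eq, ?_, ?_, ?_, ?_, ?_, c_zero, start, c_init, c_mid,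
      c_odd, c_even, c_last⟩
    · simp only [hR, hm, if_true, Finset.range_eq_Ico]
      push_cast
      omega
    · simp only [hR, if_true, hIco 0 (by omega), one_ne_zero, if_false, zero_add]
      omega
    · intro j h1 hb
      simp only [hR, hIco j (by omega), show j ≠ 0 by omega, show j + 1 ≠ 0 by omega, if_false]
      omega
    · intro j hb hj
      simp only [hR, hIco j (by omega), show j ≠ 0 by omega, show j + 1 ≠ 0 by omega, if_false]
      omega
    · simp only [hR, Finset.Ico_self, Finset.sum_empty, show N ≠ 0 by omega, if_false]
      omega
  set S := remaining n m a b d R with hS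
  have hmono : ∀ i j, i ≤ j → j ≤ N → S j ⊆ S i := by
    intro i j hij
    induction j, hij using Nat.le_induction with
    | base => exact fun _ => subset_rfl
    | succ j hij ih => exact fun hj => (D.remaining_succ_subset hj).trans (ih (by omega))
  have hdis : ∀ i < N, ∀ j < N, i ≠ j → Disjoint (S i \ S (i + 1)) (S j \ S (j + 1)) := by
    intro i hi j hj hij
    wlog h : i < j generalizing i j
    · exact (this j hj i hi hij.symm (by omega)).symm
    rw [Finset.disjoint_left]
    intro x hx hx'
    exact (Finset.mem_sdiff.1 hx).2 (hmono (i + 1) j h hj.le (Finset.mem_sdiff.1 hx').1)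
  have hNm : N ≤ m + 1 := by omega
  -- The indices of the body children of `q j`; truncation makes 1, …, n the children of index 0.
  let K : ℕ → Finset ℕ := fun j => (Finset.range N).filter fun i => 0 < i ∧ i - n = j
  have hKsub : ∀ j, (K j).image (zigzag m) ⊆ S j \ S (j + 1) := by
    intro j x hx
    obtain ⟨i, hi, rfl⟩ := Finset.mem_image.1 hx
    obtain ⟨hi', h0, rfl⟩ := Finset.mem_filter.1 hi
    exact D.zigzag_mem_remaining h0 (Finset.mem_range.1 hi')
  have hKcard : ∀ j < N, ((K j).image (zigzag m)).card = R j - R (j + 1) - (Λ j).card := by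
    intro j hj
    rw [Finset.card_image_of_injOn fun x hx y hy => zigzag_injOn
      (by have := Finset.mem_range.1 (Finset.mem_filter.1 hx).1; simp only [Set.mem_Iic]; omega)
      (by have := Finset.mem_range.1 (Finset.mem_filter.1 hy).1; simp only [Set.mem_Iic]; omega)]
    rcases Nat.eq_zero_or_pos j with rfl | h0
    · have h1 : K 0 = Finset.Icc 1 n := by
        ext i; simp only [K, Finset.mem_filter, Finset.mem_range, Finset.mem_Icc]; omega
      have := D.R_one
      rw [h1, Nat.card_Icc, zero_add]; omega
    · rcases lt_or_ge j b with hb | hb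
      · have h1 : K j = {j + n} := by
          ext i; simp only [K, Finset.mem_filter, Finset.mem_range, Finset.mem_singleton]; omega
        have := D.R_succ j h0 hb
        rw [h1, Finset.card_singleton]; omega
      · have h1 : K j = ∅ := by
          ext i; simp only [K, Finset.mem_filter, Finset.mem_range, Finset.notMem_empty, iff_false]; omega
        have := D.R_succ' j hb hj
        rw [h1, Finset.card_empty]; omega
  -- Blocks of vertices and labels: each body vertex with its zigzag value, each set of leaves with
  -- the labels kept at its step and not used by the body.
  let P : ℕ ⊕ ℕ → Finset V := Sum.elim (fun j => {q j}) Λ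
  let Q : ℕ ⊕ ℕ → Finset ℤ :=
    Sum.elim (fun j => {zigzag m j}) fun j => (S j \ S (j + 1)) \ (K j).image (zigzag m)
  let s : Finset (ℕ ⊕ ℕ) := (Finset.range N).disjSum (Finset.range N)
  have hcard : ∀ i ∈ s, (P i).card = (Q i).card := by
    rintro (j | j) hj
    · simp [P, Q]
    · have hj : j < N := by simpa [s] using hj
      have h1 := Finset.card_sdiff_add_card_eq_card (hKsub j)
      have h2 := Finset.card_sdiff_add_card_eq_card (D.remaining_succ_subset hj)
      have h3 := D.card_remaining hj.le
      have h4 := D.card_remaining (show j + 1 ≤ N from hj)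
      have h5 := hKcard j hj
      simp only [P, Q, Sum.elim_inr]
      simp only [← hS] at h2 h3 h4
      omega
  have hP : ∀ i ∈ s, ∀ j ∈ s, i ≠ j → Disjoint (P i) (P j) := by
    rintro (i | i) hi (j | j) hj hij <;>
      simp only [s, Finset.inl_mem_disjSum, Finset.inr_mem_disjSum, Finset.mem_range] at hi hj <;>
      simp only [P, Sum.elim_inl, Sum.elim_inr, Finset.disjoint_singleton_left,
        Finset.disjoint_singleton_right, Finset.mem_singleton]
    · exact fun h => hij (congrArg _ (hq i hi j hj h.symm))
    · exact hqΛ i hi j hj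
    · exact hqΛ j hj i hi
    · exact hΛ i hi j hj fun h => hij (congrArg _ h)
  have hzQ : ∀ i < N, ∀ j < N, zigzag m i ∉ (S j \ S (j + 1)) \ (K j).image (zigzag m) := by
    intro i hi j hj hmem
    obtain ⟨h1, h2⟩ := Finset.mem_sdiff.1 hmem
    rcases Nat.eq_zero_or_pos i with rfl | h0
    · have h3 := hmono 0 j (Nat.zero_le _) hj.le (Finset.mem_sdiff.1 h1).1
      rw [hS, D.remaining_zero] at h3
      simp [zigzag] at h3
    · have h3 := D.zigzag_mem_remaining h0 hi
      by_cases hij : i - n = j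
      · refine h2 (Finset.mem_image_of_mem _ (Finset.mem_filter.2 ⟨Finset.mem_range.2 hi, h0, hij⟩))
      · exact Finset.disjoint_left.1 (hdis (i - n) (by omega) j hj hij) h3 h1
  have hQ : ∀ i ∈ s, ∀ j ∈ s, i ≠ j → Disjoint (Q i) (Q j) := by
    rintro (i | i) hi (j | j) hj hij <;>
      simp only [s, Finset.inl_mem_disjSum, Finset.inr_mem_disjSum, Finset.mem_range] at hi hj <;>
      simp only [Q, Sum.elim_inl, Sum.elim_inr, Finset.disjoint_singleton_left,
        Finset.disjoint_singleton_right]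
    · rw [Finset.mem_singleton]
      exact fun h => hij (congrArg _ (zigzag_injOn (show i ≤ m by omega) (show j ≤ m by omega) h.symm))
    · exact hzQ i hi j hj
    · exact hzQ j hj i hi
    · exact (hdis i hi j hj fun h => hij (congrArg _ h)).mono Finset.sdiff_subset
        Finset.sdiff_subset
  obtain ⟨f, hinj, him⟩ := exists_injOn_image_eq s P Q hP hQ hcard
  have hA : (Finset.range N).biUnion (fun j => insert (q j) (Λ j)) = s.biUnion P := by
    ext x
    simp only [Finset.mem_biUnion, Finset.mem_range, Finset.mem_insert, s, P, Sum.exists,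
      Finset.inl_mem_disjSum, Finset.inr_mem_disjSum, Sum.elim_inl, Sum.elim_inr,
      Finset.mem_singleton]
    constructor
    · rintro ⟨j, hj, h | h⟩
      exacts [Or.inl ⟨j, hj, h⟩, Or.inr ⟨j, hj, h⟩]
    · rintro (⟨j, hj, h⟩ | ⟨j, hj, h⟩)
      exacts [⟨j, hj, Or.inl h⟩, ⟨j, hj, Or.inr h⟩]
  have hAcard : (s.biUnion P).card = m + 1 := by
    rw [Finset.card_biUnion hP, Finset.sum_disjSum]
    simp only [P, Sum.elim_inl, Sum.elim_inr, Finset.card_singleton, Finset.sum_const,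
      Finset.card_range, smul_eq_mul, mul_one]
    omega
  have hfq : ∀ j < N, f (q j) = zigzag m j := by
    intro j hj
    have := him (Sum.inl j) (by simpa [s] using hj)
    simpa [P, Q] using this
  have hmemq : ∀ j < N, q j ∈ s.biUnion P := fun j hj =>
    Finset.mem_biUnion.2 ⟨Sum.inl j, by simpa [s] using hj, by simp [P]⟩
  have hmemΛ : ∀ j < N, ∀ x ∈ Λ j, x ∈ s.biUnion P := fun j hj x hx =>
    Finset.mem_biUnion.2 ⟨Sum.inr j, by simpa [s] using hj, by simpa [P] using hx⟩
  rw [hA]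
  refine ⟨f, ?_, ?_, ?_, ?_⟩
  · intro x hx y hy hxy
    exact hinj (by simpa using hx) (by simpa using hy) hxy
  · intro x hx
    rw [hAcard]
    obtain ⟨i, hi, hx⟩ := Finset.mem_biUnion.1 hx
    have h1 : f x ∈ Q i := him i hi ▸ Finset.mem_image_of_mem f hx
    push_cast
    rcases i with j | j
    · have hj : j < N := by simpa [s] using hi
      have h1 : f x = zigzag m j := by simpa [Q] using h1
      rcases Nat.eq_zero_or_pos j with rfl | h0
      · rw [h1]; simp only [zigzag]; norm_num
      · have := zigzag_mem (m := m) (by omega) h0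
        omega
    · have hj : j < N := by simpa [s] using hi
      have h1 := (Finset.mem_sdiff.1 (Finset.mem_sdiff.1 h1).1).1
      have h2 := hmono 0 j (Nat.zero_le _) hj.le h1
      rw [hS, D.remaining_zero, Finset.mem_Icc] at h2
      omega
  · rw [hfq 0 (by omega)]; simp [zigzag]
  · intro e he0 he
    rw [hAcard] at he
    push_cast at he
    -- The difference e starts out as the one between the labels 0 and e of the star.
    obtain ⟨j, hj, x, hx, hd⟩ := exists_abs_sub_eq_of_transfer (S := S) (v := zigzag m) (N := N)
      (fun j hj x hx => by
        rw [zigzag_add_zigzag_succ]; exact D.remaining_symm hj hx) D.remaining_N (e := e) (a := e)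
      (by rw [hS, D.remaining_zero, Finset.mem_Icc]; omega)
      (by simp [zigzag, abs_of_pos he0])
    rw [← hfq j hj] at hd
    by_cases hxK : x ∈ (K j).image (zigzag m)
    · obtain ⟨i, hi, rfl⟩ := Finset.mem_image.1 hxK
      obtain ⟨hi', h0, rfl⟩ := Finset.mem_filter.1 hi
      have hi := Finset.mem_range.1 hi'
      rw [← hfq i hi] at hd
      exact ⟨q (i - n), hmemq _ hj, q i, hmemq _ hi, hadj i h0 hi, hd⟩
    · have h1 : x ∈ Q (Sum.inr j) := Finset.mem_sdiff.2 ⟨hx, hxK⟩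
      rw [← him (Sum.inr j) (by simpa [s] using hj)] at h1
      obtain ⟨y, hy, rfl⟩ := Finset.mem_image.1 h1
      have hy : y ∈ Λ j := hy
      exact ⟨q j, hmemq j hj, y, hmemΛ j hj y hy, hadj' j hj y hy, hd⟩

theorem GracefulOn.union_leaves {V : Type*} [DecidableEq V] {G : SimpleGraph V} {A B : Finset V}
    {x : V} (h : GracefulOn G A x) (hx : x ∈ A) (hAB : Disjoint A B) (hB : ∀ y ∈ B, G.Adj x y) :
    GracefulOn G (A ∪ B) x := by
  induction B using Finset.induction_on with
  | empty => simpa using h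
  | insert y B hy ih =>
    rw [Finset.disjoint_insert_right] at hAB
    rw [Finset.union_insert]
    refine (GracefulOn.insert_leaf (ih hAB.2 fun z hz => hB z (Finset.mem_insert_of_mem hz))
      (Finset.mem_union_left _ hx) ?_ (hB y (Finset.mem_insert_self _ _))).1
    rw [Finset.mem_union, not_or]
    exact ⟨hAB.1, hy⟩

/-! ### Rooted trees given by a parent function -/

/-- `G` is a tree with root `r`, the parent of `v ≠ r` being `p v`, and with level function
`lvl`. -/
structure IsRootedTree {V : Type*} (G : SimpleGraph V) (r : V) (p : V → V) (lvl : V → ℕ) :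
    Prop where
  adj_iff : ∀ u v, G.Adj u v ↔ (u ≠ r ∧ p u = v) ∨ (v ≠ r ∧ p v = u)
  lvl_root : lvl r = 0
  lvl_succ : ∀ v, v ≠ r → lvl v = lvl (p v) + 1

namespace IsRootedTree

variable {V : Type*} {G : SimpleGraph V} {r : V} {p : V → V} {lvl : V → ℕ}

theorem adj_parent (h : IsRootedTree G r p lvl) {v : V} (hv : v ≠ r) : G.Adj (p v) v :=
  (h.adj_iff _ _).2 (Or.inr ⟨hv, rfl⟩)

theorem lvl_le (h : IsRootedTree G r p lvl) {u v : V} (w : G.Walk u v) :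
    lvl v ≤ lvl u + w.length := by
  induction w with
  | nil => simp
  | @cons a b c hab w ih =>
    rw [SimpleGraph.Walk.length_cons]
    rcases (h.adj_iff a b).1 hab with ⟨h1, h2⟩ | ⟨h1, h2⟩
    · have := h.lvl_succ a h1; rw [h2] at this; omega
    · have := h.lvl_succ b h1; rw [h2] at this; omega

theorem exists_walk (h : IsRootedTree G r p lvl) (v : V) : ∃ w : G.Walk r v, w.length = lvl v := by
  induction hl : lvl v generalizing v with
  | zero =>
    by_cases hv : v = r
    · subst hv; exact ⟨.nil, rfl⟩
    · have := h.lvl_succ v hv; omega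
  | succ k ih =>
    have hv : v ≠ r := by rintro rfl; have := h.lvl_root; omega
    obtain ⟨w, hw⟩ := ih (p v) (by have := h.lvl_succ v hv; omega)
    exact ⟨w.concat (h.adj_parent hv), by rw [SimpleGraph.Walk.length_concat, hw]⟩

theorem dist_eq (h : IsRootedTree G r p lvl) (v : V) : G.dist r v = lvl v := by
  obtain ⟨w, hw⟩ := h.exists_walk v
  refine le_antisymm (hw ▸ SimpleGraph.dist_le w) ?_
  obtain ⟨w', hw'⟩ := w.reachable.exists_walk_length_eq_dist
  have := h.lvl_le w'
  rw [h.lvl_root] at this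
  omega

theorem edist_eq (h : IsRootedTree G r p lvl) (v : V) : G.edist r v = lvl v := by
  obtain ⟨w, hw⟩ := h.exists_walk v
  rw [← w.reachable.coe_dist_eq_edist, h.dist_eq]

theorem eccent_eq (h : IsRootedTree G r p lvl) {d : ℕ} (hle : ∀ v, lvl v ≤ d)
    (hd : ∃ v, lvl v = d) : G.eccent r = d := by
  apply le_antisymm
  · rw [SimpleGraph.eccent_le_iff]
    intro v
    rw [h.edist_eq]
    exact_mod_cast hle v
  · obtain ⟨v, hv⟩ := hd
    rw [← hv, ← h.edist_eq]
    exact SimpleGraph.edist_le_eccent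

theorem lvl_le_of_eccent_eq (h : IsRootedTree G r p lvl) {d : ℕ} (hd : G.eccent r = d) (v : V) :
    lvl v ≤ d := by
  have := (G.eccent_le_iff r d).1 hd.le v
  rw [h.edist_eq] at this
  exact_mod_cast this

theorem exists_lvl_eq_of_eccent_eq [Finite V] (h : IsRootedTree G r p lvl) {d : ℕ}
    (hd : G.eccent r = d) : ∃ v, lvl v = d := by
  obtain ⟨v, hv⟩ := G.exists_edist_eq_eccent_of_finite r
  rw [hd, h.edist_eq] at hv
  exact ⟨v, by exact_mod_cast hv⟩

/-- Each non-root vertex owns the edge to its parent; two vertices cannot be parents of each other,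
because levels increase. -/
theorem ncard_edgeSet [Fintype V] (h : IsRootedTree G r p lvl) :
    G.edgeSet.ncard + 1 = Fintype.card V := by
  classical
  have h1 : G.edgeSet = (fun v => s(p v, v)) '' {r}ᶜ := by
    ext e
    induction e with | _ u v
    rw [SimpleGraph.mem_edgeSet, h.adj_iff]
    simp only [Set.mem_image, Set.mem_compl_iff, Set.mem_singleton_iff, Sym2.eq_iff]
    constructor
    · rintro (⟨h1, rfl⟩ | ⟨h1, rfl⟩)
      exacts [⟨u, h1, Or.inr ⟨rfl, rfl⟩⟩, ⟨v, h1, Or.inl ⟨rfl, rfl⟩⟩]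
    · rintro ⟨w, hw, ⟨rfl, rfl⟩ | ⟨rfl, rfl⟩⟩
      exacts [Or.inr ⟨hw, rfl⟩, Or.inl ⟨hw, rfl⟩]
  rw [h1, Set.InjOn.ncard_image]
  · rw [← Nat.card_eq_fintype_card, Set.ncard_compl, Set.ncard_singleton]
    have : 0 < Nat.card V := Nat.card_pos_iff.2 ⟨⟨r⟩, inferInstance⟩
    omega
  · intro u hu v hv huv
    simp only [Sym2.eq_iff] at huv
    rcases huv with ⟨-, h2⟩ | ⟨h1, h2⟩
    · exact h2
    · have h3 := h.lvl_succ u hu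
      have h4 := h.lvl_succ v hv
      rw [h1] at h3
      rw [← h2] at h4
      omega

theorem isGraceful [Fintype V] (h : IsRootedTree G r p lvl) {x : V}
    (hG : GracefulOn G Finset.univ x) : IsGraceful G := by
  obtain ⟨f, hinj, hrange, -, hcover⟩ := hG
  have hm := h.ncard_edgeSet
  rw [Finset.card_univ] at hrange hcover
  have hf : ∀ v, ((f v).toNat : ℤ) = f v := fun v =>
    Int.toNat_of_nonneg (hrange v (Finset.mem_univ v)).1
  refine ⟨fun v => (f v).toNat, ?_, ?_, ?_⟩
  · intro u v huv
    apply hinj (Finset.mem_coe.2 (Finset.mem_univ u)) (Finset.mem_coe.2 (Finset.mem_univ v))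
    rw [← hf u, ← hf v]
    exact_mod_cast huv
  · intro v
    have := hrange v (Finset.mem_univ v)
    have := hf v
    simp only
    omega
  · ext e
    simp only [Set.mem_ofPred_eq, Set.mem_Icc, hf]
    constructor
    · rintro ⟨u, v, huv, rfl⟩
      have h1 := hrange u (Finset.mem_univ u)
      have h2 := hrange v (Finset.mem_univ v)
      have h3 : f u ≠ f v := fun h => huv.ne
        (hinj (Finset.mem_coe.2 (Finset.mem_univ u)) (Finset.mem_coe.2 (Finset.mem_univ v)) h)
      omega
    · rintro ⟨h1, h2⟩
      obtain ⟨u, -, v, -, huv, hd⟩ := hcover e (by omega) (by omega)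
      refine ⟨u, v, huv, ?_⟩
      rw [Int.abs_eq_natAbs] at hd
      exact_mod_cast hd.symm

theorem nonempty_iso {W : Type*} {G' : SimpleGraph W} {r' : W} {p' : W → W} {lvl' : W → ℕ}
    (h : IsRootedTree G r p lvl) (h' : IsRootedTree G' r' p' lvl') (φ : W → V)
    (hφ : Function.Bijective φ) (hr : φ r' = r) (hp : ∀ x, x ≠ r' → φ (p' x) = p (φ x)) :
    Nonempty (G ≃g G') := by
  have hne : ∀ x, φ x ≠ r ↔ x ≠ r' := fun x => by rw [← hr, hφ.1.ne_iff]
  let e : G' ≃g G :=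
    { toEquiv := Equiv.ofBijective φ hφ
      map_rel_iff' := by
        intro x y
        simp only [Equiv.ofBijective_apply]
        rw [h.adj_iff, h'.adj_iff, hne, hne]
        refine or_congr (and_congr_right fun hx => ?_) (and_congr_right fun hx => ?_)
        · rw [← hp x hx, hφ.1.eq_iff]
        · rw [← hp y hx, hφ.1.eq_iff] }
  exact ⟨e.symm⟩

end IsRootedTree

/-! ### Spiders with legs of equal length -/

/-- A rooted tree whose body consists of paths `u i 0 = r, u i 1, …, u i H` starting from the root
and meeting only there, such that all other vertices are children of body vertices. -/
structure IsSpider {V : Type*} (r : V) (p : V → V) {n : ℕ} (H : ℕ) (u : Fin n → ℕ → V) : Prop where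
  zero : ∀ i, u i 0 = r
  ne_root : ∀ i, ∀ l < H, u i (l + 1) ≠ r
  parent : ∀ i, ∀ l < H, p (u i (l + 1)) = u i l
  inj : ∀ i j l, 1 ≤ l → l ≤ H → u i l = u j l → i = j
  leaf : ∀ x, (∀ i, ∀ l ≤ H, x ≠ u i l) → ∃ i, ∃ l ≤ H, p x = u i l

theorem IsSpider.lvl_eq {V : Type*} {G : SimpleGraph V} {r : V} {p : V → V}
    {lvl : V → ℕ} {n H : ℕ} {u : Fin n → ℕ → V} (S : IsSpider r p H u) (T : IsRootedTree G r p lvl)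
    (i : Fin n) {l : ℕ}
    (hl : l ≤ H) : lvl (u i l) = l := by
  induction l with
  | zero => rw [S.zero, T.lvl_root]
  | succ l ih => rw [T.lvl_succ _ (S.ne_root i l hl), S.parent i l hl, ih (by omega)]

open Classical in
/-- The children of `v` outside the body of a spider. -/
noncomputable def spiderLeaves {V : Type*} [Fintype V] (p : V → V) {n : ℕ} (H : ℕ)
    (u : Fin n → ℕ → V) (v : V) : Finset V :=
  Finset.univ.filter fun x => (∀ i, ∀ l ≤ H, x ≠ u i l) ∧ p x = v

open Classical in
/-- The body vertices on the legs with indices in the range of `e`, and their leaves. -/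
noncomputable def spiderLegs {V : Type*} [Fintype V] (p : V → V) {n m : ℕ} (H : ℕ)
    (u : Fin n → ℕ → V) (e : Fin m → Fin n) : Finset V :=
  Finset.univ.filter fun x => ∃ i, ∃ l ≤ H, x = u (e i) l ∨ x ∈ spiderLeaves p H u (u (e i) l)

section

variable {V : Type*} [Fintype V] {G : SimpleGraph V} {r : V} {p : V → V} {lvl : V → ℕ}
  {n H : ℕ} {u : Fin n → ℕ → V}

theorem mem_spiderLeaves {v x : V} :
    x ∈ spiderLeaves p H u v ↔ (∀ i, ∀ l ≤ H, x ≠ u i l) ∧ p x = v := by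
  simp [spiderLeaves]

theorem mem_spiderLegs {m : ℕ} {e : Fin m → Fin n} {x : V} :
    x ∈ spiderLegs p H u e ↔ ∃ i, ∃ l ≤ H, x = u (e i) l ∨ x ∈ spiderLeaves p H u (u (e i) l) := by
  simp [spiderLegs]

theorem disjoint_spiderLeaves {v w : V} (h : v ≠ w) :
    Disjoint (spiderLeaves p H u v) (spiderLeaves p H u w) := by
  rw [Finset.disjoint_left]
  intro x hx hx'
  exact h ((mem_spiderLeaves.1 hx).2.symm.trans (mem_spiderLeaves.1 hx').2)

theorem IsSpider.adj_leaf (S : IsSpider r p H u) (T : IsRootedTree G r p lvl) {v x : V}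
    (i : Fin n) (hx : x ∈ spiderLeaves p H u v) : G.Adj v x := by
  obtain ⟨h1, rfl⟩ := mem_spiderLeaves.1 hx
  refine T.adj_parent ?_
  rw [← S.zero i]
  exact h1 i 0 (Nat.zero_le _)

/-- The legs in the range of `e`, odd in number, when sorted by the parity of the number of leaves
at their ends. -/
theorem IsSpider.gracefulOn_of_monotone (S : IsSpider r p H u) (T : IsRootedTree G r p lvl)
    {k m : ℕ} (hH : 1 ≤ H) (hk : k ≤ H)
    (hlow : ∀ i, ∀ l < H, l < k → (spiderLeaves p H u (u i l)).card = 0)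
    (hmid : ∀ i, ∀ l < H, k ≤ l →
      0 < (spiderLeaves p H u (u i l)).card ∧ (spiderLeaves p H u (u i l)).card % 2 = 0)
    (e : Fin m → Fin n) (he : Function.Injective e) (hm : m % 2 = 1) {t : ℕ} (ht : t ≤ m)
    (hodd : ∀ i : Fin m, i < t → (spiderLeaves p H u (u (e i) H)).card % 2 = 1)
    (heven : ∀ i : Fin m, t ≤ i → (spiderLeaves p H u (u (e i) H)).card % 2 = 0)
    (hlast : ∀ i j : Fin m, t ≤ i → i ≤ j → (spiderLeaves p H u (u (e i) H)).card = 0 →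
      (spiderLeaves p H u (u (e j) H)).card = 0) :
    GracefulOn G (spiderLegs p H u e) r := by
  classical
  have hm0 : 0 < m := by omega
  -- Level-by-level numbering: index 1 + i + m l is the vertex of leg i at level l + 1.
  let q : ℕ → V := fun j =>
    if j = 0 then r else u (e ⟨(j - 1) % m, Nat.mod_lt _ hm0⟩) ((j - 1) / m + 1)
  have hq0 : q 0 = r := rfl
  have hq : ∀ (i : Fin m) (l : ℕ), q (1 + i + m * l) = u (e i) (l + 1) := by
    intro i l
    have h1 : 1 + i + m * l - 1 = i + m * l := by omega
    simp only [q, show 1 + (i : ℕ) + m * l ≠ 0 by omega, if_false, h1, Nat.add_mul_mod_self_left,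
      Nat.add_mul_div_left _ _ hm0, Nat.mod_eq_of_lt i.2, Nat.div_eq_of_lt i.2, zero_add]
  have hpos : ∀ j, 0 < j → j < m * H + 1 → ∃ (i : Fin m) (l : ℕ), l < H ∧ j = 1 + i + m * l := by
    intro j h0 hj
    refine ⟨⟨(j - 1) % m, Nat.mod_lt _ hm0⟩, (j - 1) / m, ?_, ?_⟩
    · rw [Nat.div_lt_iff_lt_mul hm0, mul_comm]; omega
    · have := Nat.mod_add_div (j - 1) m
      simp only
      omega
  have hcore : ∀ j < m * H + 1, ∃ i, ∃ l ≤ H, q j = u (e i) l := by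
    intro j hj
    rcases Nat.eq_zero_or_pos j with rfl | h0
    · exact ⟨⟨0, hm0⟩, 0, Nat.zero_le _, (S.zero _).symm⟩
    · obtain ⟨i, l, hl, rfl⟩ := hpos j h0 hj
      exact ⟨i, l + 1, hl, hq i l⟩
  have hqinj : ∀ i < m * H + 1, ∀ j < m * H + 1, q i = q j → i = j := by
    intro i hi j hj hij
    have hl := congrArg lvl hij
    rcases Nat.eq_zero_or_pos i with rfl | hi0 <;> rcases Nat.eq_zero_or_pos j with rfl | hj0
    · rfl
    · obtain ⟨j, l, hl', rfl⟩ := hpos j hj0 hj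
      rw [hq0, hq, S.lvl_eq T _ (by omega), T.lvl_root] at hl
      omega
    · obtain ⟨i, l, hl', rfl⟩ := hpos i hi0 hi
      rw [hq0, hq, S.lvl_eq T _ (by omega), T.lvl_root] at hl
      omega
    · obtain ⟨j, l, hl1, rfl⟩ := hpos j hj0 hj
      obtain ⟨i, l', hl2, rfl⟩ := hpos i hi0 hi
      rw [hq, hq, S.lvl_eq T _ (by omega), S.lvl_eq T _ (by omega)] at hl
      obtain rfl : l' = l := by omega
      rw [hq, hq] at hij
      rw [he (S.inj _ _ _ (by omega) (by omega) hij)]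
  have hA : spiderLegs p H u e =
      (Finset.range (m * H + 1)).biUnion fun j => insert (q j) (spiderLeaves p H u (q j)) := by
    ext x
    simp only [mem_spiderLegs, Finset.mem_biUnion, Finset.mem_range, Finset.mem_insert]
    constructor
    · rintro ⟨i, l, hl, h⟩
      rcases l with _ | l
      · rw [S.zero] at h
        exact ⟨0, by omega, h⟩
      · refine ⟨1 + i + m * l, ?_, by rwa [hq]⟩
        have := Nat.mul_le_mul_left m hl
        rw [Nat.mul_succ] at this
        omega
    · rintro ⟨j, hj, h⟩
      obtain ⟨i, l, hl, hjl⟩ := hcore j hj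
      exact ⟨i, l, hl, by rwa [← hjl]⟩
  obtain ⟨K, rfl⟩ : ∃ K, H = K + 1 := ⟨H - 1, by omega⟩
  rw [hA, ← hq0]
  have hmK : m * (K + 1) = m * K + m := Nat.mul_succ m K
  have hlvl : ∀ i : Fin m, ∀ l l' : ℕ, 1 + (i : ℕ) + m * l < 1 + m * l' → l < l' := by
    intro i l l' h
    by_contra! hcon
    have := Nat.mul_le_mul_left m hcon
    omega
  have hlvl' : ∀ i : Fin m, ∀ l l' : ℕ, 1 + m * l' ≤ 1 + (i : ℕ) + m * l → l' ≤ l := by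
    intro i l l' h
    by_contra! hcon
    have := Nat.mul_le_mul_left m (show l + 1 ≤ l' from hcon)
    rw [Nat.mul_succ] at this
    omega
  have htop : ∀ j, m * K + 1 ≤ j → j < m * (K + 1) + 1 → ∃ i : Fin m, j = m * K + 1 + i ∧
      q j = u (e i) (K + 1) := by
    intro j h1 h2
    refine ⟨⟨j - (m * K + 1), by omega⟩, by simp only; omega, ?_⟩
    rw [← hq]
    congr 1
    simp only
    omega
  -- Level l ≥ 1 occupies the indices m (l - 1) + 1, …, m l. So `a` begins level k (level 1 if k =
  -- 0, the root being treated apart), `b` begins the last level, and `d` is its first end with an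
  -- even number of leaves.
  refine gracefulOn_of_odd (n := m) (a := if k = 0 then 1 else m * (k - 1) + 1) (b := m * K + 1)
    (d := m * K + 1 + t) hm ?_ ?_ ?_ ?_ ?_ hqinj ?_ ?_ ?_ ?_ ?_ ?_ ?_ ?_ ?_ ?_ ?_
  · split_ifs <;> omega
  · split_ifs
    · omega
    · have := Nat.mul_le_mul_left m (show k - 1 ≤ K by omega)
      omega
  · omega
  · omega
  · omega
  · exact fun i hi j hj hij => disjoint_spiderLeaves fun h => hij (hqinj i hi j hj h)
  · intro i hi j hj hmem
    obtain ⟨i', l, hl, hil⟩ := hcore i hi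
    exact (mem_spiderLeaves.1 hmem).1 _ l hl hil
  · intro j h0 hj
    obtain ⟨i, l, hl, rfl⟩ := hpos j h0 hj
    have h1 : q (1 + i + m * l - m) = p (q (1 + i + m * l)) := by
      rw [hq, S.parent _ _ hl]
      rcases l with _ | l
      · rw [show 1 + (i : ℕ) + m * 0 - m = 0 by have := i.2; omega, hq0, S.zero]
      · rw [← hq, Nat.mul_succ]
        congr 1
        omega
    rw [h1]
    refine T.adj_parent ?_
    rw [hq]
    exact S.ne_root _ _ hl
  · intro j hj x hx
    exact S.adj_leaf T (e ⟨0, hm0⟩) hx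
  · rw [hq0, ← S.zero (e ⟨0, hm0⟩)]
    rcases Nat.eq_zero_or_pos k with h | h
    · exact (hmid _ 0 (by omega) (by omega)).2
    · rw [hlow _ 0 (by omega) h]
  · rcases Nat.eq_zero_or_pos k with h | h
    · exact Or.inl (if_pos h)
    · right
      rw [hq0, ← S.zero (e ⟨0, hm0⟩), hlow _ 0 (by omega) h]
  · intro j h1 hj
    split_ifs at hj with hk0
    · omega
    · have := Nat.mul_le_mul_left m (show k - 1 ≤ K by omega)
      obtain ⟨i, l, hl, rfl⟩ := hpos j h1 (by omega)
      have := hlvl i l (k - 1) (by omega)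
      rw [hq]
      exact hlow _ _ (by omega) (by omega)
  · intro j h1 hj
    have h0 : 0 < j := by split_ifs at h1 <;> omega
    obtain ⟨i, l, hl, rfl⟩ := hpos j h0 (by omega)
    have := hlvl i l K (by omega)
    rw [hq]
    refine hmid _ _ (by omega) ?_
    split_ifs at h1 with hk0
    · omega
    · have := hlvl' i l (k - 1) (by omega)
      omega
  · intro j h1 hj
    obtain ⟨i, rfl, hi⟩ := htop j h1 (by omega)
    rw [hi]
    exact hodd i (by omega)
  · intro j h1 hj
    obtain ⟨i, rfl, hi⟩ := htop j (by omega) (by omega)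
    rw [hi]
    exact heven i (by omega)
  · intro j h1 hj h
    obtain ⟨i, rfl, hi⟩ := htop j (by omega) (by omega)
    obtain ⟨i', h2, hi'⟩ := htop (m * K + 1 + i + 1) (by omega) (by omega)
    rw [hi] at h
    rw [hi']
    exact hlast i i' (by omega) (Fin.le_def.2 (by omega)) h

/-- The hypotheses above the leg ends are the same for all legs, so the legs may be permuted and
hence sorted. -/
theorem IsSpider.gracefulOn_of_odd (S : IsSpider r p H u) (T : IsRootedTree G r p lvl)
    {k m : ℕ} (hH : 1 ≤ H) (hk : k ≤ H)
    (hlow : ∀ i, ∀ l < H, l < k → (spiderLeaves p H u (u i l)).card = 0)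
    (hmid : ∀ i, ∀ l < H, k ≤ l →
      0 < (spiderLeaves p H u (u i l)).card ∧ (spiderLeaves p H u (u i l)).card % 2 = 0)
    (e : Fin m → Fin n) (he : Function.Injective e) (hm : m % 2 = 1) :
    GracefulOn G (spiderLegs p H u e) r := by
  classical
  let c : Fin m → ℕ := fun i => (spiderLeaves p H u (u (e i) H)).card
  let key : Fin m → ℕ := fun i => if c i % 2 = 1 then 0 else if c i = 0 then 2 else 1
  obtain ⟨σ, hσ⟩ : ∃ σ : Equiv.Perm (Fin m), Monotone (key ∘ σ) :=
    ⟨Tuple.sort key, Tuple.monotone_sort key⟩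
  have hlegs : spiderLegs p H u e = spiderLegs p H u (e ∘ σ) := by
    ext x
    simp only [mem_spiderLegs, Function.comp_apply]
    constructor
    · rintro ⟨i, h⟩
      exact ⟨σ.symm i, by rwa [Equiv.apply_symm_apply]⟩
    · rintro ⟨i, h⟩
      exact ⟨σ i, h⟩
  -- t is the number of legs whose end carries an odd number of leaves; after sorting they come
  -- first.
  obtain ⟨t, ht, htk⟩ : ∃ t ≤ m, ∀ i : Fin m, i < t ↔ key (σ i) = 0 := by
    by_cases h : ∃ s, ∃ hs : s < m, key (σ ⟨s, hs⟩) ≠ 0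
    · obtain ⟨hs, hne⟩ := Nat.find_spec h
      refine ⟨Nat.find h, hs.le, fun i => ⟨fun hi => ?_, fun hi => ?_⟩⟩
      · have := Nat.find_min h hi
        push Not at this
        exact this i.2
      · by_contra! hcon
        have := hσ (show (⟨Nat.find h, hs⟩ : Fin m) ≤ i from hcon)
        simp only [Function.comp_apply] at this
        omega
    · push Not at h
      exact ⟨m, le_rfl, fun i => ⟨fun _ => h i i.2, fun _ => i.2⟩⟩
  rw [hlegs]
  refine S.gracefulOn_of_monotone T hH hk hlow hmid (e ∘ σ) (he.comp σ.injective) hm ht ?_ ?_ ?_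
  · intro i hi
    have := (htk i).1 hi
    by_contra hcon
    change ¬ c (σ i) % 2 = 1 at hcon
    simp only [key, hcon, if_false] at this
    split_ifs at this
  · intro i hi
    by_contra hcon
    have h1 : c (σ i) % 2 = 1 := Nat.mod_two_ne_zero.1 hcon
    have := (htk i).2 (if_pos h1)
    omega
  · intro i j hi hij h0
    change c (σ i) = 0 at h0
    change c (σ j) = 0
    have h1 := hσ hij
    simp only [Function.comp_apply, key, h0] at h1
    by_contra hcon
    simp only [hcon, if_false] at h1
    split_ifs at h1 <;> omega

/-- The last leg of a spider, which is a caterpillar, can be attached to the other legs. -/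
theorem IsSpider.gracefulOn_univ_of_castSucc {u : Fin (n + 1) → ℕ → V}
    (S : IsSpider r p H u) (T : IsRootedTree G r p lvl)
    (hn : 0 < n) (h : GracefulOn G (spiderLegs p H u Fin.castSucc) r) :
    ∃ x, GracefulOn G Finset.univ x := by
  classical
  let i₀ := Fin.last n
  -- The last leg down to level k. Level 0 is excluded, since the root and its leaves are already
  -- among the other legs.
  let B : ℕ → Finset V := fun k => Finset.univ.filter fun x =>
    ∃ l, 1 ≤ l ∧ l ≤ k ∧ (x = u i₀ l ∨ x ∈ spiderLeaves p H u (u i₀ l))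
  have hB : ∀ k x, x ∈ B k ↔
      ∃ l, 1 ≤ l ∧ l ≤ k ∧ (x = u i₀ l ∨ x ∈ spiderLeaves p H u (u i₀ l)) := by
    intro k x
    simp [B]
  have hr : r ∈ spiderLegs p H u Fin.castSucc :=
    mem_spiderLegs.2 ⟨⟨0, hn⟩, 0, Nat.zero_le _, Or.inl (S.zero _).symm⟩
  have hnotcore : ∀ k < H, u i₀ (k + 1) ∉ spiderLegs p H u Fin.castSucc := by
    intro k hk hmem
    obtain ⟨i, l, hl, h | h⟩ := mem_spiderLegs.1 hmem
    · have h1 := congrArg lvl h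
      rw [S.lvl_eq T _ hk, S.lvl_eq T _ hl] at h1
      subst h1
      exact (Fin.castSucc_lt_last i).ne' (S.inj _ _ _ (by omega) hl h)
    · exact (mem_spiderLeaves.1 h).1 _ _ hk rfl
  have hnotB : ∀ k < H, u i₀ (k + 1) ∉ B k := by
    intro k hk hmem
    obtain ⟨l, h1, hl, h | h⟩ := (hB _ _).1 hmem
    · have h1 := congrArg lvl h
      rw [S.lvl_eq T _ hk, S.lvl_eq T _ (by omega)] at h1
      omega
    · exact (mem_spiderLeaves.1 h).1 _ _ hk rfl
  -- The label 0 travels down the leg: at each level the next body vertex is inserted and takes over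
  -- the 0, then its leaves are inserted.
  have key : ∀ k ≤ H, GracefulOn G (spiderLegs p H u Fin.castSucc ∪ B k) (u i₀ k) ∧
      u i₀ k ∈ spiderLegs p H u Fin.castSucc ∪ B k := by
    intro k
    induction k with
    | zero =>
      intro _
      have h0 : B 0 = ∅ := by
        ext x
        simp only [hB, Finset.notMem_empty, iff_false]
        rintro ⟨l, h1, h2, -⟩
        omega
      rw [h0, Finset.union_empty, S.zero]
      exact ⟨h, hr⟩
    | succ k ih =>
      intro hk
      obtain ⟨ih1, ih2⟩ := ih (by omega)
      have hx : u i₀ (k + 1) ∉ spiderLegs p H u Fin.castSucc ∪ B k := by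
        rw [Finset.mem_union, not_or]
        exact ⟨hnotcore k hk, hnotB k hk⟩
      have hadj : G.Adj (u i₀ k) (u i₀ (k + 1)) := by
        rw [← S.parent _ _ hk]
        exact T.adj_parent (S.ne_root _ _ hk)
      have h1 := (ih1.insert_leaf ih2 hx hadj).2
      have h2 := h1.union_leaves (B := spiderLeaves p H u (u i₀ (k + 1)))
        (Finset.mem_insert_self _ _) ?_ fun y hy => S.adj_leaf T i₀ hy
      · have h3 : insert (u i₀ (k + 1)) (spiderLegs p H u Fin.castSucc ∪ B k) ∪
            spiderLeaves p H u (u i₀ (k + 1)) = spiderLegs p H u Fin.castSucc ∪ B (k + 1) := by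
          ext x
          simp only [Finset.mem_union, Finset.mem_insert, hB]
          constructor
          · rintro ((h | h | ⟨l, h1, h2, h3⟩) | h)
            exacts [Or.inr ⟨k + 1, by omega, le_rfl, Or.inl h⟩, Or.inl h,
              Or.inr ⟨l, h1, by omega, h3⟩, Or.inr ⟨k + 1, by omega, le_rfl, Or.inr h⟩]
          · rintro (h | ⟨l, h1, h2, h3⟩)
            · exact Or.inl (Or.inr (Or.inl h))
            · rcases Nat.lt_or_ge k l with hl | hl
              · obtain rfl : l = k + 1 := by omega
                rcases h3 with h | h
                exacts [Or.inl (Or.inl h), Or.inr h]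
              · exact Or.inl (Or.inr (Or.inr ⟨l, h1, hl, h3⟩))
        rw [h3] at h2
        exact ⟨h2, Finset.mem_union_right _ ((hB _ _).2 ⟨k + 1, by omega, le_rfl, Or.inl rfl⟩)⟩
      · rw [Finset.disjoint_left]
        intro x hx hx'
        obtain ⟨hx1, hx2⟩ := mem_spiderLeaves.1 hx'
        rcases Finset.mem_insert.1 hx with rfl | hx
        · exact hx1 i₀ (k + 1) hk rfl
        rcases Finset.mem_union.1 hx with hx | hx
        · obtain ⟨i, l, hl, h | h⟩ := mem_spiderLegs.1 hx
          · exact hx1 _ _ hl h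
          · exact hnotcore k hk (mem_spiderLegs.2
              ⟨i, l, hl, Or.inl (hx2.symm.trans (mem_spiderLeaves.1 h).2)⟩)
        · obtain ⟨l, h1, hl, h | h⟩ := (hB _ _).1 hx
          · exact hx1 _ _ (by omega) h
          · exact hnotB k hk ((hB _ _).2
              ⟨l, h1, hl, Or.inl (hx2.symm.trans (mem_spiderLeaves.1 h).2)⟩)
  have huniv : spiderLegs p H u Fin.castSucc ∪ B H = Finset.univ := by
    refine Finset.eq_univ_of_forall fun x => ?_
    have hcore : ∀ i, ∀ l ≤ H, (x = u i l ∨ x ∈ spiderLeaves p H u (u i l)) →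
        x ∈ spiderLegs p H u Fin.castSucc ∪ B H := by
      intro i l hl h
      rw [Finset.mem_union, mem_spiderLegs, hB]
      rcases Fin.eq_castSucc_or_eq_last i with ⟨j, rfl⟩ | rfl
      · exact Or.inl ⟨j, l, hl, h⟩
      · rcases Nat.eq_zero_or_pos l with rfl | h0
        · refine Or.inl ⟨⟨0, hn⟩, 0, hl, ?_⟩
          rwa [S.zero] at h ⊢
        · exact Or.inr ⟨l, h0, hl, h⟩
    by_cases hx : ∀ i, ∀ l ≤ H, x ≠ u i l
    · obtain ⟨i, l, hl, h⟩ := S.leaf x hx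
      exact hcore i l hl (Or.inr (mem_spiderLeaves.2 ⟨hx, h⟩))
    · push Not at hx
      obtain ⟨i, l, hl, h⟩ := hx
      exact hcore i l hl (Or.inl h)
  exact ⟨_, huniv ▸ (key H le_rfl).1⟩

theorem IsSpider.isGraceful (S : IsSpider r p H u) (T : IsRootedTree G r p lvl)
    {k : ℕ} (hn : 0 < n) (hH : 1 ≤ H) (hk : k ≤ H)
    (hlow : ∀ i, ∀ l < H, l < k → (spiderLeaves p H u (u i l)).card = 0)
    (hmid : ∀ i, ∀ l < H, k ≤ l →
      0 < (spiderLeaves p H u (u i l)).card ∧ (spiderLeaves p H u (u i l)).card % 2 = 0) :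
    IsGraceful G := by
  suffices h : ∃ x, GracefulOn G Finset.univ x from T.isGraceful h.choose_spec
  rcases Nat.mod_two_eq_zero_or_one n with h | h
  · obtain ⟨m, rfl⟩ : ∃ m, n = m + 1 := ⟨n - 1, by omega⟩
    exact S.gracefulOn_univ_of_castSucc T (by omega) (S.gracefulOn_of_odd T hH hk hlow hmid _
      (Fin.castSucc_injective m) (by omega))
  · refine ⟨r, ?_⟩
    have h1 := S.gracefulOn_of_odd T hH hk hlow hmid _ Function.injective_id h
    have h2 : spiderLegs p H u id = Finset.univ := by
      refine Finset.eq_univ_of_forall fun x => mem_spiderLegs.2 ?_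
      by_cases hx : ∀ i, ∀ l ≤ H, x ≠ u i l
      · obtain ⟨i, l, hl, h⟩ := S.leaf x hx
        exact ⟨i, l, hl, Or.inr (mem_spiderLeaves.2 ⟨hx, h⟩)⟩
      · push Not at hx
        obtain ⟨i, l, hl, h⟩ := hx
        exact ⟨i, l, hl, Or.inl h⟩
    rwa [h2] at h1

end

/-! ### Even-caterpillar banana trees are graceful -/

theorem IsGraceful.of_iso {V W : Type*} {G : SimpleGraph V} {G' : SimpleGraph W} (φ : G ≃g G')
    (h : IsGraceful G') : IsGraceful G := by
  obtain ⟨f, hinj, hle, hset⟩ := h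
  have hcard : G.edgeSet.ncard = G'.edgeSet.ncard :=
    Nat.card_congr φ.mapEdgeSet
  refine ⟨f ∘ φ, hinj.comp φ.injective, fun v => by rw [hcard]; exact hle _, ?_⟩
  rw [hcard, ← hset]
  ext e
  constructor
  · rintro ⟨u, v, huv, rfl⟩
    exact ⟨φ u, φ v, φ.map_adj_iff.2 huv, rfl⟩
  · rintro ⟨u, v, huv, rfl⟩
    exact ⟨φ.symm u, φ.symm v, φ.symm.map_adj_iff.2 huv, by simp⟩

/-- Attaching leaves to a rooted tree. -/
theorem IsRootedTree.attachLeaves {V : Type*} {G : SimpleGraph V} {r : V} {p : V → V}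
    {lvl : V → ℕ} (T : IsRootedTree G r p lvl) (t : V → ℕ) :
    IsRootedTree (attachLeaves G t) (.inl r) (Sum.elim (Sum.inl ∘ p) fun x => .inl x.1)
      (Sum.elim lvl fun x => lvl x.1 + 1) where
  adj_iff := by
    rintro (u | x) (v | y)
    · simp [GracefulTrees.attachLeaves, T.adj_iff]
    · simp [GracefulTrees.attachLeaves, eq_comm]
    · simp [GracefulTrees.attachLeaves]
    · simp [GracefulTrees.attachLeaves]
  lvl_root := T.lvl_root
  lvl_succ := by
    rintro (u | x) h
    · exact T.lvl_succ u fun hu => h (congrArg _ hu)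
    · rfl

section

variable {n h : ℕ} {s : Fin n → ℕ}

/-- The parent of a vertex of a generalized banana tree (the apex for the apex itself). -/
def bananaParent : BananaVertex h s → BananaVertex h s
  | .apex => .apex
  | .spine i j => if j.val = 0 then .apex else .spine i ⟨j.val - 1, by omega⟩
  | .tip i _ => .spine i (Fin.last h)

/-- The level of a vertex of a generalized banana tree. -/
def bananaLevel : BananaVertex h s → ℕ
  | .apex => 0
  | .spine _ j => j.val + 1
  | .tip _ _ => h + 2

theorem isParent_iff (x y : BananaVertex h s) :
    IsParent x y ↔ y ≠ .apex ∧ bananaParent y = x := by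
  rcases y with _ | ⟨i, j⟩ | ⟨i, a⟩
  · rcases x with _ | ⟨i', j'⟩ | ⟨i', a'⟩ <;> simp [IsParent]
  · by_cases hj : j.val = 0
    · rcases x with _ | ⟨i', j'⟩ | ⟨i', a'⟩ <;> simp [IsParent, bananaParent, hj]
    · rcases x with _ | ⟨i', j'⟩ | ⟨i', a'⟩ <;> simp [IsParent, bananaParent, hj, Fin.ext_iff]
      omega
  · rcases x with _ | ⟨i', j'⟩ | ⟨i', a'⟩ <;> simp [IsParent, bananaParent, Fin.ext_iff]
    omega

theorem isRootedTree_bananaGraph :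
    IsRootedTree (bananaGraph h s) .apex bananaParent bananaLevel := by
  have hlvl : ∀ v : BananaVertex h s, v ≠ .apex → bananaLevel v = bananaLevel (bananaParent v) + 1
  · rintro (_ | ⟨i, j⟩ | ⟨i, a⟩) hv
    · exact absurd rfl hv
    · by_cases hj : j.val = 0
      · simp [bananaParent, bananaLevel, hj]
      · simp only [bananaParent, bananaLevel, hj, if_false]
        omega
    · simp [bananaParent, bananaLevel]
  refine ⟨fun u v => ?_, rfl, hlvl⟩
  rw [bananaGraph, SimpleGraph.fromRel_adj, isParent_iff, isParent_iff]
  constructor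
  · rintro ⟨-, h1 | h1⟩
    exacts [Or.inr h1, Or.inl h1]
  · intro h1
    refine ⟨?_, h1.symm⟩
    rintro rfl
    rcases h1 with ⟨h1, h2⟩ | ⟨h1, h2⟩ <;>
    · have := hlvl _ h1
      rw [h2] at this
      omega

theorem bananaLevel_le (x : BananaVertex h s) : bananaLevel x ≤ h + 2 := by
  rcases x with _ | ⟨i, j⟩ | ⟨i, a⟩ <;> simp only [bananaLevel] <;> omega

/-- The vertex at level `l ≤ h + 1` on the `i`-th path from the apex to the centre of a star. -/
def bananaSpine (h : ℕ) (s : Fin n → ℕ) (i : Fin n) (l : ℕ) : BananaVertex h s :=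
  if l = 0 then .apex else .spine i ⟨min (l - 1) h, by omega⟩

theorem exists_eq_bananaSpine (hn : 0 < n) {x : BananaVertex h s} (hx : bananaLevel x ≤ h + 1) :
    ∃ i, x = bananaSpine h s i (bananaLevel x) := by
  rcases x with _ | ⟨i, j⟩ | ⟨i, a⟩
  · exact ⟨⟨0, hn⟩, rfl⟩
  · refine ⟨i, ?_⟩
    simp only [bananaSpine, bananaLevel, Nat.add_eq_zero_iff, one_ne_zero, and_false, if_false]
    congr 1
    ext
    simp only
    omega
  · simp [bananaLevel] at hx

theorem bananaLevel_bananaSpine (i : Fin n) {l : ℕ} (hl : l ≤ h + 1) :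
    bananaLevel (bananaSpine h s i l) = l := by
  unfold bananaSpine
  split_ifs with h0
  · simp [bananaLevel, h0]
  · simp only [bananaLevel]
    omega

/-- The leg length H is kept free: if all stars are single edges, the deepest level is that of the
star centres, and the body must stop one level earlier. -/
theorem isSpider_attachLeaves_bananaGraph {t : BananaVertex h s → ℕ} {H : ℕ} (hn : 0 < n)
    (hH : H ≤ h + 1) (hle : ∀ x : BananaVertex h s, bananaLevel x ≤ H + 1)
    (ht : ∀ v, t v ≠ 0 → bananaLevel v < H) :
    IsSpider (V := BananaVertex h s ⊕ Σ v, Fin (t v)) (.inl .apex)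
      (Sum.elim (Sum.inl ∘ bananaParent) fun x => .inl x.1) H
      fun i l => .inl (bananaSpine h s i l) where
  zero _ := rfl
  ne_root i l _ := by simp [bananaSpine]
  parent i l hl := by
    simp only [bananaSpine, Nat.add_eq_zero_iff, one_ne_zero, and_false, if_false, Sum.elim_inl,
      Function.comp_apply, bananaParent, Nat.add_sub_cancel, Sum.inl.injEq]
    rcases Nat.eq_zero_or_pos l with rfl | h0
    · simp
    · rw [if_neg (by omega), if_neg (by omega)]
      congr 2
      omega
  inj i j l h1 _ hij := by
    simp only [bananaSpine, show l ≠ 0 by omega, if_false, Sum.inl.injEq,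
      BananaVertex.spine.injEq] at hij
    exact hij.1
  leaf := by
    have hcore : ∀ v : BananaVertex h s, bananaLevel v ≤ H →
        ∃ i, ∃ l ≤ H, v = bananaSpine h s i l := fun v hv =>
      (exists_eq_bananaSpine hn (hv.trans hH)).imp fun i hi => ⟨_, hv, hi⟩
    rintro (v | ⟨v, a⟩) hx
    · have h1 : ¬ bananaLevel v ≤ H := by
        intro h1
        obtain ⟨i, l, hl, hv⟩ := hcore v h1
        exact hx i l hl (congrArg _ hv)
      have h2 := isRootedTree_bananaGraph.lvl_succ v (by rintro rfl; exact h1 (Nat.zero_le _))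
      obtain ⟨i, l, hl, hv⟩ := hcore (bananaParent v) (by have := hle v; omega)
      exact ⟨i, l, hl, congrArg _ hv⟩
    · have := a.2
      obtain ⟨i, l, hl, hv⟩ := hcore v (ht v (by omega)).le
      exact ⟨i, l, hl, congrArg _ hv⟩

theorem card_spiderLeaves_attachLeaves_bananaGraph {t : BananaVertex h s → ℕ} {H : ℕ}
    [Fintype (BananaVertex h s ⊕ Σ v, Fin (t v))] (hn : 0 < n)
    (hH : H ≤ h + 1) (v : BananaVertex h s) (hv : bananaLevel v < H) :
    (spiderLeaves (V := BananaVertex h s ⊕ Σ v, Fin (t v))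
      (Sum.elim (Sum.inl ∘ bananaParent) fun x => .inl x.1) H
      (fun i l => .inl (bananaSpine h s i l)) (.inl v)).card = t v := by
  classical
  have h1 : spiderLeaves (V := BananaVertex h s ⊕ Σ v, Fin (t v))
      (Sum.elim (Sum.inl ∘ bananaParent) fun x => .inl x.1) H
      (fun i l => .inl (bananaSpine h s i l)) (.inl v) =
      (Finset.univ : Finset (Fin (t v))).image fun a => .inr ⟨v, a⟩ := by
    ext x
    simp only [mem_spiderLeaves, Finset.mem_image, Finset.mem_univ, true_and]
    constructor
    · rintro ⟨hx, hp⟩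
      rcases x with w | ⟨w, a⟩
      · exfalso
        simp only [Sum.elim_inl, Function.comp_apply, Sum.inl.injEq] at hp
        have h2 : bananaLevel w ≤ H := by
          by_cases hw : w = .apex
          · rw [hw]; exact Nat.zero_le _
          · rw [isRootedTree_bananaGraph.lvl_succ w hw, hp]; exact hv
        obtain ⟨i, hi⟩ := exists_eq_bananaSpine hn (h2.trans hH)
        exact hx i _ h2 (congrArg _ hi)
      · simp only [Sum.elim_inr, Sum.inl.injEq] at hp
        subst hp
        exact ⟨a, rfl⟩
    · rintro ⟨a, rfl⟩
      exact ⟨fun i l _ => by simp, rfl⟩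
  rw [h1, Finset.card_image_of_injective, Finset.card_univ, Fintype.card_fin]
  intro a b hab
  simpa using hab

end

theorem IsEvenCaterpillarBananaTree.isGraceful {V : Type*} [Fintype V] {G : SimpleGraph V}
    (hG : IsEvenCaterpillarBananaTree G) : IsGraceful G := by
  obtain ⟨n, h, s, d, k, t, -, hecc, hkd, hpos, hzero, ⟨φ⟩⟩ := hG
  refine IsGraceful.of_iso φ ?_
  let _ : Fintype (BananaVertex h s ⊕ Σ v, Fin (t v)) := Fintype.ofEquiv V φ.toEquiv
  have : Finite (BananaVertex h s) :=
    Finite.of_injective (Sum.inl : _ → BananaVertex h s ⊕ Σ v, Fin (t v)) Sum.inl_injective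
  have T := isRootedTree_bananaGraph (h := h) (s := s)
  simp only [T.dist_eq] at hpos hzero
  have hle := T.lvl_le_of_eccent_eq hecc
  obtain ⟨v, hv⟩ := T.exists_lvl_eq_of_eccent_eq hecc
  have hdh := bananaLevel_le v
  have hn : 0 < n := by
    rcases v with _ | ⟨i, j⟩ | ⟨i, a⟩
    · have h0 : (0 : ℕ) = d := hv
      omega
    · exact i.pos
    · exact i.pos
  have hd1 : ∀ w, t w ≠ 0 → bananaLevel w + 2 ≤ d := fun w hw => by
    by_contra hcon
    exact hw (hzero w fun h1 => hcon h1.2)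
  -- The body ends at level d - 1, so that the levels carrying attached leaves lie strictly before
  -- its ends. The maximum with 1 keeps the legs nontrivial when d = 1.
  have hH : max 1 (d - 1) ≤ h + 1 := by omega
  have hc := fun (i : Fin n) (l : ℕ) (hl : l < max 1 (d - 1)) =>
    card_spiderLeaves_attachLeaves_bananaGraph (t := t) hn hH (bananaSpine h s i l)
      (by rwa [bananaLevel_bananaSpine i (by omega)])
  refine (isSpider_attachLeaves_bananaGraph hn hH (fun x => by have := hle x; omega)
    fun v hv => by have := hd1 v hv; omega).isGraceful (T.attachLeaves t) hn (le_max_left _ _)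
    -- For d = 1 no level carries attached leaves, so the apex has to count as lying below k.
    (k := if d = 1 then 1 else k) ?_ ?_ ?_
  · split_ifs <;> omega
  · intro i l hl hlk
    rw [hc i l hl]
    apply hzero
    rw [bananaLevel_bananaSpine i (by omega)]
    split_ifs at hlk <;> omega
  · intro i l hl hlk
    rw [hc i l hl]
    have := hpos (bananaSpine h s i l)
    rw [bananaLevel_bananaSpine i (by omega)] at this
    split_ifs at hlk with hd
    · omega
    · obtain ⟨h1, h2⟩ := this hlk (by omega)
      exact ⟨h1, Nat.even_iff.1 h2⟩

/-! ### Generalized banana trees -/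

/-- Attaching no leaves changes nothing. -/
def attachLeavesZeroIso {V : Type*} (G : SimpleGraph V) : G ≃g attachLeaves G fun _ => 0 where
  toFun := Sum.inl
  invFun := Sum.elim id fun x => x.2.elim0
  left_inv _ := rfl
  right_inv := by
    rintro (v | x)
    · rfl
    · exact x.2.elim0
  map_rel_iff' := Iff.rfl

theorem IsGeneralizedBananaTree.isEvenCaterpillarBananaTree {V : Type*} [Finite V] [Nontrivial V]
    {G : SimpleGraph V} (hG : IsGeneralizedBananaTree G) : IsEvenCaterpillarBananaTree G := by
  obtain ⟨n, h, s, hs, ⟨φ⟩⟩ := hG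
  have : Finite (BananaVertex h s) := Finite.of_equiv V φ.toEquiv
  have : Nontrivial (BananaVertex h s) := φ.toEquiv.symm.nontrivial
  have T := isRootedTree_bananaGraph (h := h) (s := s)
  obtain ⟨v, hv⟩ := (bananaGraph h s).exists_edist_eq_eccent_of_finite .apex
  have hd : (bananaGraph h s).eccent .apex = (bananaLevel v : ℕ∞) := by rw [← hv, T.edist_eq]
  have h0 : bananaLevel v ≠ 0 := fun h0 => by
    rw [h0] at hd
    exact (bananaGraph h s).eccent_ne_zero _ hd
  -- With k = d - 1 no level l satisfies k ≤ l ≤ d - 2.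
  refine ⟨n, h, s, bananaLevel v, bananaLevel v - 1, fun _ => 0, hs, hd, by omega, ?_,
    fun _ _ => rfl, ⟨φ.trans (attachLeavesZeroIso _)⟩⟩
  intro w h1 h2
  omega

theorem IsBananaTree.isGeneralizedBananaTree {V : Type*} {G : SimpleGraph V}
    (hG : IsBananaTree G) : IsGeneralizedBananaTree G :=
  let ⟨n, s, hs⟩ := hG
  ⟨n, 1, s, hs⟩

/-! ### Spiders that are even-caterpillar banana trees -/

/-- The elements of a finite set, numbered from `0`; junk values equal to `r` afterwards. -/
noncomputable def nthElement {V : Type*} (r : V) (F : Finset V) (a : ℕ) : V :=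
  if h : a < F.card then (F.equivFin.symm ⟨a, h⟩ : V) else r

theorem nthElement_mem {V : Type*} {r : V} {F : Finset V} {a : ℕ} (h : a < F.card) :
    nthElement r F a ∈ F := by
  rw [nthElement, dif_pos h]
  exact (F.equivFin.symm ⟨a, h⟩).2

theorem nthElement_inj {V : Type*} {r : V} {F : Finset V} {a b : ℕ} (ha : a < F.card)
    (hb : b < F.card) (hab : nthElement r F a = nthElement r F b) : a = b := by
  rw [nthElement, nthElement, dif_pos ha, dif_pos hb] at hab
  simpa using F.equivFin.symm.injective (Subtype.ext hab)

theorem exists_nthElement_eq {V : Type*} {r : V} {F : Finset V} {x : V} (hx : x ∈ F) :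
    ∃ a < F.card, nthElement r F a = x := by
  refine ⟨F.equivFin ⟨x, hx⟩, (F.equivFin ⟨x, hx⟩).2, ?_⟩
  rw [nthElement, dif_pos (F.equivFin ⟨x, hx⟩).2]
  simp

section

variable {V : Type*} {G : SimpleGraph V} {r : V} {p : V → V} {lvl : V → ℕ} {n h : ℕ}
  {u : Fin n → ℕ → V} {s : Fin n → ℕ}

/-- The body vertex of a spider with the given position in a generalized banana tree. -/
def bodyVertex (r : V) (u : Fin n → ℕ → V) : BananaVertex h s → V
  | .apex => r
  | .spine i j => u i (j + 1)
  | .tip _ _ => r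

theorem bodyVertex_bananaSpine (S : IsSpider r p (h + 1) u) (i : Fin n) {l : ℕ}
    (hl : l ≤ h + 1) : bodyVertex r u (bananaSpine h s i l) = u i l := by
  unfold bananaSpine
  split_ifs with h0
  · rw [h0, S.zero]; rfl
  · simp only [bodyVertex]
    congr 1
    omega

theorem exists_bodyVertex_eq (S : IsSpider r p (h + 1) u) {v : BananaVertex h s} (hn : 0 < n)
    (hv : bananaLevel v ≤ h + 1) : ∃ i, bodyVertex r u v = u i (bananaLevel v) := by
  obtain ⟨i, hi⟩ := exists_eq_bananaSpine hn hv
  exact ⟨i, by rw [hi, bodyVertex_bananaSpine S i hv, ← hi]⟩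

theorem bodyVertex_inj (S : IsSpider r p (h + 1) u) (T : IsRootedTree G r p lvl) (hn : 0 < n)
    {v w : BananaVertex h s} (hv : bananaLevel v ≤ h + 1) (hw : bananaLevel w ≤ h + 1)
    (hvw : bodyVertex r u v = bodyVertex r u w) : v = w := by
  obtain ⟨i, hi⟩ := exists_eq_bananaSpine hn hv
  obtain ⟨j, hj⟩ := exists_eq_bananaSpine hn hw
  rw [hi, hj, bodyVertex_bananaSpine S i hv, bodyVertex_bananaSpine S j hw] at hvw
  have hl := congrArg lvl hvw
  rw [S.lvl_eq T i hv, S.lvl_eq T j hw] at hl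
  rw [← hl] at hj hvw
  rcases Nat.eq_zero_or_pos (bananaLevel v) with h0 | h0
  · rw [h0] at hi hj
    rw [hi, hj]
    rfl
  · rw [hi, hj, S.inj i j _ h0 hv hvw]

end

section

variable {V : Type*} [Fintype V] {G : SimpleGraph V} {r : V} {p : V → V} {lvl : V → ℕ}
  {n h : ℕ} {u : Fin n → ℕ → V} {s : Fin n → ℕ}

/-- The vertex of a spider that corresponds to a given vertex of a generalized banana tree with
attached leaves. -/
noncomputable def spiderVertex (r : V) (p : V → V) (u : Fin n → ℕ → V)
    {t : BananaVertex h s → ℕ} : BananaVertex h s ⊕ (Σ v, Fin (t v)) → V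
  | .inl (.tip i a) => nthElement r (spiderLeaves p (h + 1) u (u i (h + 1))) a
  | .inl v => bodyVertex r u v
  | .inr ⟨v, a⟩ => nthElement r (spiderLeaves p (h + 1) u (bodyVertex r u v)) a

theorem spiderVertex_eq_bodyVertex {t : BananaVertex h s → ℕ} {v : BananaVertex h s}
    (hv : bananaLevel v ≤ h + 1) : spiderVertex r p u (t := t) (.inl v) = bodyVertex r u v := by
  rcases v with _ | ⟨i, j⟩ | ⟨i, a⟩
  · rfl
  · rfl
  · simp [bananaLevel] at hv

/-- Leaves at the leg ends play the role of the remaining star leaves, and all other leaves are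
attached ones. Body and leaves have disjoint images, and a leaf is determined by its parent and its
number. -/
theorem IsSpider.nonempty_iso (S : IsSpider r p (h + 1) u) (T : IsRootedTree G r p lvl)
    (hn : 0 < n) {t : BananaVertex h s → ℕ}
    (hs : ∀ i, s i - 1 = (spiderLeaves p (h + 1) u (u i (h + 1))).card)
    (ht : ∀ v, bananaLevel v < h + 1 → t v = (spiderLeaves p (h + 1) u (bodyVertex r u v)).card)
    (ht' : ∀ v, h + 1 ≤ bananaLevel v → t v = 0) :
    Nonempty (G ≃g attachLeaves (bananaGraph h s) t) := by
  have htlt : ∀ (v) (_ : Fin (t v)), bananaLevel v < h + 1 := fun v a => by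
    by_contra hcon
    have := ht' v (by omega)
    have := a.2
    omega
  have hleaf : ∀ x : BananaVertex h s ⊕ Σ v, Fin (t v),
      (∃ v, x = .inl v ∧ bananaLevel v ≤ h + 1) ∨
      spiderVertex r p u x ∈ spiderLeaves p (h + 1) u (bodyVertex r u
        (Sum.elim bananaParent (fun y => y.1) x)) := by
    rintro ((_ | ⟨i, j⟩ | ⟨i, a⟩) | ⟨v, a⟩)
    · exact Or.inl ⟨_, rfl, Nat.zero_le _⟩
    · exact Or.inl ⟨_, rfl, by simp only [bananaLevel]; omega⟩
    · right
      simp only [spiderVertex, Sum.elim_inl, bananaParent, bodyVertex, Fin.val_last]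
      exact nthElement_mem (by rw [← hs]; exact a.2)
    · right
      simp only [spiderVertex, Sum.elim_inr]
      exact nthElement_mem (by rw [← ht v (htlt v a)]; exact a.2)
  have hbody : ∀ v : BananaVertex h s, bananaLevel v ≤ h + 1 → ∀ w : V,
      bodyVertex r u v ∉ spiderLeaves p (h + 1) u w := by
    intro v hv w hmem
    obtain ⟨i, hi⟩ := exists_bodyVertex_eq S hn hv
    exact (mem_spiderLeaves.1 hmem).1 i _ hv hi
  refine T.nonempty_iso (isRootedTree_bananaGraph.attachLeaves t) (spiderVertex r p u)
    ⟨?_, ?_⟩ rfl ?_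
  · intro x y hxy
    rcases hleaf x with ⟨v, rfl, hv⟩ | hx <;> rcases hleaf y with ⟨w, rfl, hw⟩ | hy
    · rw [spiderVertex_eq_bodyVertex hv, spiderVertex_eq_bodyVertex hw] at hxy
      rw [bodyVertex_inj S T hn hv hw hxy]
    · rw [← hxy, spiderVertex_eq_bodyVertex hv] at hy
      exact absurd hy (hbody v hv _)
    · rw [hxy, spiderVertex_eq_bodyVertex hw] at hx
      exact absurd hx (hbody w hw _)
    · have hlvl : ∀ x : BananaVertex h s ⊕ Σ v, Fin (t v), bananaLevel
          (Sum.elim bananaParent (fun y => y.1) x : BananaVertex h s) ≤ h + 1 := by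
        rintro (v | ⟨v, a⟩)
        · by_cases hv : v = .apex
          · rw [hv]; exact Nat.zero_le _
          · have := isRootedTree_bananaGraph.lvl_succ v hv
            have := bananaLevel_le v
            simp only [Sum.elim_inl]
            omega
        · exact (htlt v a).le
      have hpar := (mem_spiderLeaves.1 hx).2.symm.trans
        ((congrArg p hxy).trans (mem_spiderLeaves.1 hy).2)
      replace hpar := bodyVertex_inj S T hn (hlvl x) (hlvl y) hpar
      have hin : ∀ v, spiderVertex r p u (t := t) (.inl v) ∈ spiderLeaves p (h + 1) u
          (bodyVertex r u (bananaParent v)) → ∃ i a, v = .tip i a := by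
        rintro (_ | ⟨i, j⟩ | ⟨i, a⟩) hmem
        · exact absurd hmem (hbody .apex (Nat.zero_le _) _)
        · exact absurd hmem (hbody (.spine i j) (by simp only [bananaLevel]; omega) _)
        · exact ⟨i, a, rfl⟩
      rcases x with v | ⟨v, a⟩ <;> rcases y with w | ⟨w, b⟩
      · obtain ⟨i, a, rfl⟩ := hin v hx
        obtain ⟨j, b, rfl⟩ := hin w hy
        simp only [Sum.elim_inl, bananaParent, BananaVertex.spine.injEq, and_true] at hpar
        subst hpar
        simp only [spiderVertex] at hxy
        have := nthElement_inj (by rw [← hs]; exact a.2) (by rw [← hs]; exact b.2) hxy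
        rw [Fin.ext this]
      · obtain ⟨i, a, rfl⟩ := hin v hx
        have := htlt w b
        simp only [Sum.elim_inl, Sum.elim_inr, bananaParent] at hpar
        rw [← hpar] at this
        simp [bananaLevel] at this
      · obtain ⟨i, b, rfl⟩ := hin w hy
        have := htlt v a
        simp only [Sum.elim_inl, Sum.elim_inr, bananaParent] at hpar
        rw [hpar] at this
        simp [bananaLevel] at this
      · simp only [Sum.elim_inr] at hpar
        subst hpar
        simp only [spiderVertex] at hxy
        have h1 := ht v (htlt v a)
        have := nthElement_inj (by rw [← h1]; exact a.2) (by rw [← h1]; exact b.2) hxy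
        rw [Fin.ext this]
  · intro x
    by_cases hx : ∀ i, ∀ l ≤ h + 1, x ≠ u i l
    · obtain ⟨i, l, hl, hp⟩ := S.leaf x hx
      obtain ⟨a, ha, hax⟩ := exists_nthElement_eq (r := r) (mem_spiderLeaves.2 ⟨hx, hp⟩)
      rcases Nat.lt_or_ge l (h + 1) with hlt | hge
      · have h1 := bodyVertex_bananaSpine (s := s) S i hl
        refine ⟨.inr ⟨bananaSpine h s i l, ⟨a, ?_⟩⟩, ?_⟩
        · rwa [ht _ (by rwa [bananaLevel_bananaSpine i hl]), h1]
        · simp only [spiderVertex]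
          rw [h1, hax]
      · obtain rfl : l = h + 1 := by omega
        exact ⟨.inl (.tip i ⟨a, by rwa [hs]⟩), hax⟩
    · push Not at hx
      obtain ⟨i, l, hl, rfl⟩ := hx
      exact ⟨.inl (bananaSpine h s i l), by
        rw [spiderVertex_eq_bodyVertex (by rwa [bananaLevel_bananaSpine i hl]),
          bodyVertex_bananaSpine S i hl]⟩
  · intro x hx
    rcases hleaf x with ⟨v, rfl, hv⟩ | h1
    · have hv0 : v ≠ .apex := fun h => hx (congrArg _ h)
      rcases v with _ | ⟨i, j⟩ | ⟨i, a⟩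
      · exact absurd rfl hv0
      · have h1 := S.parent i j j.2
        simp only [Sum.elim_inl, Function.comp_apply, bananaParent]
        split_ifs with hj
        · rw [hj, S.zero] at h1
          simp only [spiderVertex, bodyVertex, hj]
          exact h1.symm
        · simp only [spiderVertex, bodyVertex, h1]
          congr 1
          omega
      · simp [bananaLevel] at hv
    · rw [(mem_spiderLeaves.1 h1).2]
      rcases x with v | ⟨v, a⟩
      · have h2 := isRootedTree_bananaGraph.lvl_succ v fun h => hx (congrArg _ h)
        have h3 := bananaLevel_le v
        exact spiderVertex_eq_bodyVertex (by omega)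
      · exact spiderVertex_eq_bodyVertex (htlt v a).le

theorem IsSpider.isEvenCaterpillarBananaTree (S : IsSpider r p (h + 1) u)
    (T : IsRootedTree G r p lvl) (hn : 0 < n) {c : ℕ} (hc : Even c)
    (hroot : (spiderLeaves p (h + 1) u r).card = 0)
    (hmid : ∀ i, ∀ l, 1 ≤ l → l < h + 1 → (spiderLeaves p (h + 1) u (u i l)).card = c)
    (htop : (∀ i, 0 < (spiderLeaves p (h + 1) u (u i (h + 1))).card) ∨
      h = 0 ∧ ∀ i, (spiderLeaves p (h + 1) u (u i (h + 1))).card = 0) :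
    IsEvenCaterpillarBananaTree G := by
  -- One leaf of each star is spent on the path to the apex.
  let s : Fin n → ℕ := fun i => (spiderLeaves p (h + 1) u (u i (h + 1))).card + 1
  let t : BananaVertex h s → ℕ := fun v =>
    if bananaLevel v < h + 1 then (spiderLeaves p (h + 1) u (bodyVertex r u v)).card else 0
  have B := isRootedTree_bananaGraph (h := h) (s := s)
  have hiso := S.nonempty_iso T hn (s := s) (t := t) (fun i => by simp [s])
    (fun v hv => if_pos hv) (fun v hv => if_neg (by omega))
  have ht : ∀ v, 1 ≤ bananaLevel v → bananaLevel v < h + 1 → t v = c := by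
    intro v h1 h2
    obtain ⟨i, hi⟩ := exists_bodyVertex_eq S hn h2.le
    simp only [t, if_pos h2, hi]
    exact hmid i _ h1 h2
  have ht0 : ∀ v, bananaLevel v = 0 → t v = 0 := by
    rintro (_ | ⟨i, j⟩ | ⟨i, a⟩) hv
    · simpa [t, bananaLevel, bodyVertex] using hroot
    · simp [bananaLevel] at hv
    · simp [bananaLevel] at hv
  have ht1 : ∀ v, h + 1 ≤ bananaLevel v → t v = 0 := fun v hv => if_neg (by omega)
  rcases htop with htop | ⟨rfl, htop⟩
  · have hecc : (bananaGraph h s).eccent .apex = ((h + 2 : ℕ) : ℕ∞) :=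
      B.eccent_eq bananaLevel_le ⟨.tip ⟨0, hn⟩ ⟨0, by simpa [s] using htop ⟨0, hn⟩⟩, rfl⟩
    -- For c = 0 the level range must be empty, as attached numbers are positive; otherwise it
    -- consists of all levels from 1 to h.
    refine ⟨n, h, s, h + 2, if c = 0 then h + 1 else 1, t, fun i => by simp [s], hecc, ?_, ?_, ?_,
      hiso⟩
    · split_ifs <;> omega
    · intro v h1 h2
      rw [B.dist_eq] at h1 h2
      split_ifs at h1 with hc0
      · omega
      · rw [ht v h1 (by omega)]
        exact ⟨by omega, hc⟩
    · intro v hv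
      rw [B.dist_eq] at hv
      rcases Nat.eq_zero_or_pos (bananaLevel v) with h0 | h0
      · exact ht0 v h0
      · rcases Nat.lt_or_ge (bananaLevel v) (h + 1) with h1 | h1
        · rw [ht v h0 h1]
          split_ifs at hv with hc0
          · exact hc0
          · omega
        · exact ht1 v h1
  · have hecc : (bananaGraph 0 s).eccent .apex = ((1 : ℕ) : ℕ∞) := by
      refine B.eccent_eq ?_ ⟨.spine ⟨0, hn⟩ 0, rfl⟩
      rintro (_ | ⟨i, j⟩ | ⟨i, a⟩)
      · simp [bananaLevel]
      · simp only [bananaLevel]; omega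
      · have := a.2
        simp only [s, htop i] at this
        omega
    refine ⟨n, 0, s, 1, 0, t, fun i => by simp [s], hecc, by omega, ?_, ?_, hiso⟩
    · intro v _ h2
      omega
    · intro v _
      rcases Nat.eq_zero_or_pos (bananaLevel v) with h0 | h0
      · exact ht0 v h0
      · exact ht1 v h0

end

/-! ### Distances in trees and caterpillars -/

section

variable {W : Type*} {T : SimpleGraph W}

/-- In a tree, a vertex has only one neighbour that is closer to `x`. -/
theorem eq_of_adj_of_dist_eq (hT : T.IsTree) {x a a' b : W} (ha : T.Adj a b) (ha' : T.Adj a' b)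
    (hd : T.dist x b = T.dist x a + 1) (hd' : T.dist x b = T.dist x a' + 1) : a = a' := by
  obtain ⟨w, hw⟩ := hT.connected.exists_walk_length_eq_dist x a
  obtain ⟨w', hw'⟩ := hT.connected.exists_walk_length_eq_dist x a'
  have h1 : (w.concat ha).IsPath :=
    (w.concat ha).isPath_of_length_eq_dist (by rw [SimpleGraph.Walk.length_concat]; omega)
  have h2 : (w'.concat ha').IsPath :=
    (w'.concat ha').isPath_of_length_eq_dist (by rw [SimpleGraph.Walk.length_concat]; omega)
  have h3 := congrArg SimpleGraph.Walk.penultimate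
    ((hT.existsUnique_path x b).unique h1 h2)
  simpa using h3

/-- A step from `a` to `b` away from `x` is followed by another step away from `x`, unless it is
reversed. -/
theorem dist_eq_add_one_of_ne (hT : T.IsTree) {x a b c : W} (hab : T.Adj a b) (hbc : T.Adj b c)
    (hac : a ≠ c) (hd : T.dist x b = T.dist x a + 1) : T.dist x c = T.dist x b + 1 := by
  rcases hT.dist_eq_dist_add_one_of_adj x hbc with h | h
  · exact absurd (eq_of_adj_of_dist_eq hT hab hbc.symm hd h) hac
  · exact h

/-- In a tree, a step away from x can only be followed by a step back along the same edge or by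
another step away; without backtracking the distance keeps growing. -/
theorem dist_eq_add_of_forall_ne (hT : T.IsTree) {x : W} {f : ℕ → W} {L : ℕ}
    (hadj : ∀ i < L, T.Adj (f i) (f (i + 1))) (hne : ∀ i, i + 2 ≤ L → f i ≠ f (i + 2))
    (hd : 1 ≤ L → T.dist x (f 1) = T.dist x (f 0) + 1) :
    ∀ i ≤ L, T.dist x (f i) = T.dist x (f 0) + i := by
  have key : ∀ i, i + 1 ≤ L → T.dist x (f i) = T.dist x (f 0) + i ∧
      T.dist x (f (i + 1)) = T.dist x (f 0) + i + 1 := by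
    intro i
    induction i with
    | zero => exact fun h => ⟨rfl, hd h⟩
    | succ i ih =>
      intro h
      obtain ⟨h1, h2⟩ := ih (by omega)
      refine ⟨by omega, ?_⟩
      rw [dist_eq_add_one_of_ne hT (hadj i (by omega)) (hadj (i + 1) h) (hne i h) (by omega), h2]
      omega
  intro i hi
  rcases Nat.eq_zero_or_pos i with rfl | h0
  · rfl
  · obtain ⟨j, rfl⟩ : ∃ j, i = j + 1 := ⟨i - 1, by omega⟩
    exact (key j hi).2

theorem dist_eq_of_forall_ne (hT : T.IsTree) {f : ℕ → W} {L : ℕ}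
    (hadj : ∀ i < L, T.Adj (f i) (f (i + 1))) (hne : ∀ i, i + 2 ≤ L → f i ≠ f (i + 2)) :
    ∀ i ≤ L, T.dist (f 0) (f i) = i := by
  intro i hi
  have := dist_eq_add_of_forall_ne hT (x := f 0) hadj hne (fun h => by
    rw [SimpleGraph.dist_self, zero_add, SimpleGraph.dist_eq_one_iff_adj]
    exact hadj 0 h) i hi
  rwa [SimpleGraph.dist_self, zero_add] at this

/-- Every tree is rooted at any of its vertices. -/
theorem exists_isRootedTree (hT : T.IsTree) (r : W) :
    ∃ p : W → W, IsRootedTree T r p (T.dist r) := by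
  have h : ∀ v, ∃ w, v ≠ r → T.Adj w v ∧ T.dist r v = T.dist r w + 1 := by
    intro v
    by_cases hv : v = r
    · exact ⟨v, fun h => absurd hv h⟩
    · obtain ⟨q, hq⟩ := hT.connected.exists_walk_length_eq_dist r v
      have h0 := hT.connected.pos_dist_of_ne (Ne.symm hv)
      have hnil : ¬ q.Nil := by
        rw [SimpleGraph.Walk.not_nil_iff_lt_length]
        omega
      refine ⟨q.penultimate, fun _ => ⟨q.adj_penultimate hnil, ?_⟩⟩
      rcases hT.dist_eq_dist_add_one_of_adj r (q.adj_penultimate hnil) with h | h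
      · have := SimpleGraph.dist_le q.dropLast
        have : q.dropLast.length = q.length - 1 := by simp
        omega
      · exact h
  choose p hp using h
  refine ⟨p, fun u v => ?_, SimpleGraph.dist_self, fun v hv => (hp v hv).2⟩
  constructor
  · intro huv
    rcases hT.dist_eq_dist_add_one_of_adj r huv with h | h
    · have hu : u ≠ r := by rintro rfl; rw [SimpleGraph.dist_self] at h; omega
      exact Or.inl ⟨hu, eq_of_adj_of_dist_eq hT (hp u hu).1 huv.symm (hp u hu).2 h⟩
    · have hv : v ≠ r := by rintro rfl; rw [SimpleGraph.dist_self] at h; omega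
      exact Or.inr ⟨hv, eq_of_adj_of_dist_eq hT (hp v hv).1 huv (hp v hv).2 h⟩
  · rintro (⟨hu, rfl⟩ | ⟨hv, rfl⟩)
    exacts [(hp u hu).1.symm, (hp v hv).1]

/-- A caterpillar contains no three paths of length `2` that start at the same vertex `y` and meet
only there. -/
theorem IsCaterpillar.not_claw (hT : IsCaterpillar T) {y : W} {a : Fin 3 → W}
    (ha : Function.Injective a) (hya : ∀ i, T.Adj y (a i))
    (ha' : ∀ i, ∃ z, T.Adj (a i) z ∧ z ≠ y) : False := by
  obtain ⟨hT, α, β, q, hq, hcov⟩ := hT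
  have hdist : ∀ i j, i ≤ j → j ≤ q.length → T.dist (q.getVert i) (q.getVert j) = j - i := by
    intro i j hij hj
    have := dist_eq_of_forall_ne hT (f := fun k => q.getVert (i + k)) (L := q.length - i)
      (fun k hk => q.adj_getVert_succ (by omega))
      (fun k hk h => by
        have := hq.getVert_injOn (show i + k ≤ q.length by omega)
          (show i + (k + 2) ≤ q.length by omega) h
        omega) (j - i) (by omega)
    simpa [Nat.add_sub_cancel' hij] using this
  -- Convexity of the path: the neighbour of d closer to b is unique, and the path already contains
  -- one.
  have hconv : ∀ {b c d : W}, b ∈ q.support → d ∈ q.support → T.Adj c d →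
      T.dist b d = T.dist b c + 1 → c ∈ q.support := by
    intro b c d hb hd hcd h
    obtain ⟨i, rfl, hi⟩ := SimpleGraph.Walk.mem_support_iff_exists_getVert.1 hb
    obtain ⟨j, rfl, hj⟩ := SimpleGraph.Walk.mem_support_iff_exists_getVert.1 hd
    rcases lt_trichotomy i j with hij | rfl | hij
    · obtain ⟨k, rfl⟩ : ∃ k, j = k + 1 := ⟨j - 1, by omega⟩
      rw [eq_of_adj_of_dist_eq hT hcd (q.adj_getVert_succ (i := k) (by omega)) h
        (by rw [hdist _ _ (by omega) hj, hdist _ _ (by omega) (by omega)]; omega)]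
      exact q.getVert_mem_support _
    · rw [SimpleGraph.dist_self] at h
      omega
    · rw [eq_of_adj_of_dist_eq hT hcd (q.adj_getVert_succ (i := j) (by omega)).symm h
        (by rw [SimpleGraph.dist_comm, hdist _ _ (by omega) hi, SimpleGraph.dist_comm,
              hdist _ _ (by omega) hi]; omega)]
      exact q.getVert_mem_support _
  have hcov' : ∀ x ∉ q.support, ∃ z ∈ q.support, T.Adj x z := by
    intro x hx
    obtain ⟨z, hz, hd⟩ := hcov x
    refine ⟨z, hz, ?_⟩
    rw [← SimpleGraph.dist_eq_one_iff_adj]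
    have := hT.connected.pos_dist_of_ne (show x ≠ z by rintro rfl; exact hx hz)
    omega
  -- A vertex with two neighbours lies on the path. Otherwise it hangs on some w of the path and has
  -- a neighbour z farther from w; z or a neighbour of z is on the path, and convexity brings x onto
  -- it.
  have hint : ∀ x z z', T.Adj x z → T.Adj x z' → z ≠ z' → x ∈ q.support := by
    intro x z z' hz hz' hne
    by_contra hx
    obtain ⟨w, hw, hxw⟩ := hcov' x hx
    wlog hzw : z ≠ w generalizing z z'
    · push Not at hzw
      exact this z' z hz' hz hne.symm (by rw [← hzw]; exact hne.symm)
    have h1 : T.dist w x = 1 := SimpleGraph.dist_eq_one_iff_adj.2 hxw.symm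
    have h2 : T.dist w z = T.dist w x + 1 :=
      dist_eq_add_one_of_ne hT hxw.symm hz hzw.symm (by rw [h1, SimpleGraph.dist_self])
    have hzq : z ∈ q.support := by
      by_contra hzq
      obtain ⟨w', hw', hzw'⟩ := hcov' z hzq
      exact hzq (hconv hw hw' hzw' (dist_eq_add_one_of_ne hT hz hzw'
        (by rintro rfl; exact hx hw') h2))
    exact hx (hconv hw hzq hz h2)
  have haq : ∀ i, a i ∈ q.support := fun i => by
    obtain ⟨z, hz, hzy⟩ := ha' i
    exact hint _ _ _ hz (hya i).symm hzy
  have hy : y ∈ q.support :=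
    hint _ _ _ (hya 0) (hya 1) (ha.ne (by decide))
  obtain ⟨k, rfl, hk⟩ := SimpleGraph.Walk.mem_support_iff_exists_getVert.1 hy
  -- All a i lie on the path next to y, where there is room for only two vertices.
  have hidx : ∀ i, ∃ j ≤ q.length, a i = q.getVert j ∧ (j + 1 = k ∨ j = k + 1) := by
    intro i
    obtain ⟨j, hj, hjl⟩ := SimpleGraph.Walk.mem_support_iff_exists_getVert.1 (haq i)
    have h1 := SimpleGraph.dist_eq_one_iff_adj.2 (hya i)
    rw [← hj] at h1
    refine ⟨j, hjl, hj.symm, ?_⟩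
    rcases le_total j k with h | h
    · rw [SimpleGraph.dist_comm, hdist _ _ h hk] at h1
      omega
    · rw [hdist _ _ h hjl] at h1
      omega
  choose j hj1 hj2 hj3 using hidx
  have hjinj : ∀ i i', i ≠ i' → j i ≠ j i' := fun i i' hii h =>
    hii (ha (by rw [hj2, hj2, h]))
  have h01 := hjinj 0 1 (by decide)
  have h02 := hjinj 0 2 (by decide)
  have h12 := hjinj 1 2 (by decide)
  have h0 := hj3 0
  have h1 := hj3 1
  have h2 := hj3 2
  omega

theorem injective_vec_three {a b c : W} (hab : a ≠ b) (hac : a ≠ c) (hbc : b ≠ c) :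
    Function.Injective ![a, b, c] := by
  intro i j hij
  fin_cases i <;> fin_cases j <;> simp_all

/-- A caterpillar rooted at an end of a longest path `u 0, …, u N`: all other vertices are joined
to internal vertices of this path. -/
theorem IsCaterpillar.exists_spine [Finite W] (hT : IsCaterpillar T) {r : W} {N : ℕ}
    (hr : T.eccent r = N) (hd : T.ediam = N) :
    ∃ u : ℕ → W, u 0 = r ∧ (∀ l < N, T.Adj (u l) (u (l + 1))) ∧
      (∀ l ≤ N, T.dist r (u l) = l) ∧
      ∀ x, (∀ l ≤ N, x ≠ u l) → ∃ l, 1 ≤ l ∧ l + 1 ≤ N ∧ T.Adj (u l) x ∧ T.dist r x = l + 1 := by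
  have hTree := hT.1
  have hdiam : ∀ a b, T.dist a b ≤ N := by
    intro a b
    have := T.edist_le_ediam (u := a) (v := b)
    rw [hd, ← (hTree.connected a b).coe_dist_eq_edist] at this
    exact_mod_cast this
  obtain ⟨z, hz⟩ := T.exists_edist_eq_eccent_of_finite r
  rw [hr, ← (hTree.connected r z).coe_dist_eq_edist] at hz
  have hz : T.dist r z = N := by exact_mod_cast hz
  obtain ⟨q, hqp, hq⟩ := hTree.connected.exists_path_of_dist r z
  have hqN : q.length = N := by omega
  have hadj : ∀ l < N, T.Adj (q.getVert l) (q.getVert (l + 1)) :=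
    fun l hl => q.adj_getVert_succ (by omega)
  have hinj : ∀ i j, i ≤ N → j ≤ N → q.getVert i = q.getVert j → i = j := fun i j hi hj h =>
    hqp.getVert_injOn (show i ≤ q.length by omega) (show j ≤ q.length by omega) h
  have hdr : ∀ l ≤ N, T.dist r (q.getVert l) = l := by
    intro l hl
    have := dist_eq_of_forall_ne hTree (f := q.getVert) hadj
      (fun k hk h => by have := hinj _ _ (by omega) hk h; omega) l hl
    rwa [q.getVert_zero] at this
  have hdz : ∀ l ≤ N, T.dist z (q.getVert l) = N - l := by
    intro l hl
    have := dist_eq_of_forall_ne hTree (f := fun k => q.getVert (N - k)) (L := N)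
      (fun k hk => by
        have := (hadj (N - (k + 1)) (by omega)).symm
        rwa [show N - (k + 1) + 1 = N - k by omega] at this)
      (fun k hk h => by have := hinj _ _ (by omega) (by omega) h; omega) (N - l) (by omega)
    rw [show N - (N - l) = l by omega, Nat.sub_zero, ← hqN, q.getVert_length] at this
    omega
  refine ⟨q.getVert, q.getVert_zero, hadj, hdr, ?_⟩
  intro x hx
  -- The path vertex nearest to x; a geodesic g from it to x leaves the path at once.
  obtain ⟨s, hs, hmin⟩ := Finset.exists_min_image (Finset.range (N + 1))
    (fun l => T.dist (q.getVert l) x) ⟨0, by simp⟩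
  have hsN : s ≤ N := by have := Finset.mem_range.1 hs; omega
  have hmin' : ∀ l ≤ N, T.dist (q.getVert s) x ≤ T.dist (q.getVert l) x :=
    fun l hl => hmin l (Finset.mem_range.2 (by omega))
  obtain ⟨g, hw0, hwe, hwadj, hwne, hg1⟩ : ∃ g : ℕ → W, g 0 = q.getVert s ∧
      g (T.dist (q.getVert s) x) = x ∧
      (∀ l < T.dist (q.getVert s) x, T.Adj (g l) (g (l + 1))) ∧
      (∀ l, l + 2 ≤ T.dist (q.getVert s) x → g l ≠ g (l + 2)) ∧
      T.dist (g 1) x ≤ T.dist (q.getVert s) x - 1 := by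
    obtain ⟨w, hwp, hw⟩ := hTree.connected.exists_path_of_dist (q.getVert s) x
    refine ⟨w.getVert, w.getVert_zero, by rw [← hw, w.getVert_length],
      fun l hl => w.adj_getVert_succ (by omega), fun l hl h => ?_, ?_⟩
    · have := hwp.getVert_injOn (show l ≤ w.length by omega) (show l + 2 ≤ w.length by omega) h
      omega
    · rw [← hw, ← SimpleGraph.Walk.drop_length]
      exact SimpleGraph.dist_le _
  have he0 : 0 < T.dist (q.getVert s) x := hTree.connected.pos_dist_of_ne (hx s hsN).symm
  generalize he : T.dist (q.getVert s) x = e at *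
  have hwoff : ∀ l ≤ N, g 1 ≠ q.getVert l := by
    intro l hl h
    have h1 := hmin' l hl
    rw [← h] at h1
    omega
  have hadj1 : T.Adj (q.getVert s) (g 1) := hw0 ▸ hwadj 0 he0
  have hr1 : T.dist r (g 1) = s + 1 := by
    rcases hTree.dist_eq_dist_add_one_of_adj r hadj1 with h | h
    · rw [hdr s hsN] at h
      obtain ⟨k, rfl⟩ : ∃ k, s = k + 1 := ⟨s - 1, by omega⟩
      exact absurd (eq_of_adj_of_dist_eq hTree hadj1.symm (hadj k (by omega))
        (by rw [hdr _ hsN, h]) (by rw [hdr _ hsN, hdr k (by omega)])) (hwoff k (by omega))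
    · rw [h, hdr s hsN]
  have hz1 : T.dist z (g 1) = N - s + 1 := by
    rcases hTree.dist_eq_dist_add_one_of_adj z hadj1 with h | h
    · rw [hdz s hsN] at h
      exact absurd (eq_of_adj_of_dist_eq hTree hadj1.symm (hadj s (by omega)).symm
        (by rw [hdz _ hsN, h]) (by rw [hdz _ hsN, hdz (s + 1) (by omega)]; omega))
        (hwoff (s + 1) (by omega))
    · rw [h, hdz s hsN]
  have hrx := dist_eq_add_of_forall_ne hTree (x := r) hwadj hwne
    (fun _ => by rw [hw0, hr1, hdr s hsN]) e le_rfl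
  have hzx := dist_eq_add_of_forall_ne hTree (x := z) hwadj hwne
    (fun _ => by rw [hw0, hz1, hdz s hsN]) e le_rfl
  rw [hw0, hwe, hdr s hsN] at hrx
  rw [hw0, hwe, hdz s hsN] at hzx
  have h1 := hdiam r x
  have h2 := hdiam z x
  -- x has distance s + e from r and N - s + e from z, both at most N, so e ≤ s and e ≤ N - s. If e
  -- ≥ 2, both arms of the path and the branch g have length at least 2 at index s: a claw.
  have he1 : e = 1 := by
    by_contra hne
    refine hT.not_claw (y := q.getVert s)
      (a := ![g 1, q.getVert (s - 1), q.getVert (s + 1)]) ?_ ?_ ?_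
    · have h3 := hwoff (s - 1) (by omega)
      have h4 := hwoff (s + 1) (by omega)
      have h5 : q.getVert (s - 1) ≠ q.getVert (s + 1) := fun h => by
        have := hinj _ _ (by omega) (by omega) h
        omega
      exact injective_vec_three h3 h4 h5
    · have h3 := (hadj (s - 1) (by omega)).symm
      rw [show s - 1 + 1 = s by omega] at h3
      intro i
      fin_cases i
      exacts [hadj1, h3, hadj s (by omega)]
    · intro i
      fin_cases i
      · exact ⟨g 2, hwadj 1 (by omega), fun h => hwne 0 (by omega) (hw0.trans h.symm)⟩
      · refine ⟨q.getVert (s - 2), ?_, fun h => ?_⟩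
        · have h3 := (hadj (s - 2) (by omega)).symm
          rwa [show s - 2 + 1 = s - 1 by omega] at h3
        · have := hinj _ _ (by omega) (by omega) h
          omega
      · refine ⟨q.getVert (s + 2), hadj (s + 1) (by omega), fun h => ?_⟩
        have := hinj _ _ (by omega) (by omega) h
        omega
  exact ⟨s, by omega, by omega, SimpleGraph.dist_eq_one_iff_adj.1 (he.trans he1), by omega⟩

end

/-! ### Arbitrarily fixed generalized banana trees -/

theorem IsRootedTree.parent_eq {V : Type*} {G : SimpleGraph V} {r : V} {p : V → V} {lvl : V → ℕ}
    (T : IsRootedTree G r p lvl) {a b : V} (hab : G.Adj a b) (h : lvl b = lvl a + 1) :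
    b ≠ r ∧ p b = a := by
  rcases (T.adj_iff a b).1 hab with ⟨h1, h2⟩ | h1
  · have := T.lvl_succ a h1
    rw [h2] at this
    omega
  · exact h1

section

variable {V ι : Type*} {G : SimpleGraph V} {r : V} {C : ι → G.Subgraph}

theorem IsWedge.exists_mem (hC : IsWedge G r C) (v : V) : ∃ i, v ∈ (C i).verts := by
  have h : v ∈ (⨆ i, C i).verts := by rw [hC.2.2]; exact Set.mem_univ v
  simpa using h

theorem IsWedge.adj_iff (hC : IsWedge G r C) (a b : V) : G.Adj a b ↔ ∃ i, (C i).Adj a b := by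
  rw [← SimpleGraph.Subgraph.iSup_adj, hC.2.2, SimpleGraph.Subgraph.top_adj]

theorem IsWedge.eq_of_mem (hC : IsWedge G r C) {v : V} (hv : v ≠ r) {i j : ι}
    (hi : v ∈ (C i).verts) (hj : v ∈ (C j).verts) : i = j := by
  by_contra hij
  have h : v ∈ (C i).verts ∩ (C j).verts := ⟨hi, hj⟩
  rw [hC.2.1 i j hij] at h
  exact hv h

/-- Every vertex other than r lies in exactly one piece, so parents and levels of the pieces glue;
at r all levels are 0. -/
theorem IsWedge.exists_isRootedTree (hC : IsWedge G r C) {p : ∀ i, (C i).verts → (C i).verts}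
    (hp : ∀ i, IsRootedTree (C i).coe ⟨r, hC.1 i⟩ (p i) ((C i).coe.dist ⟨r, hC.1 i⟩)) :
    ∃ (P : V → V) (lvl : V → ℕ), IsRootedTree G r P lvl ∧
      (∀ i (x : (C i).verts), x.1 ≠ r → P x = p i x) ∧
      ∀ i (x : (C i).verts), lvl x = (C i).coe.dist ⟨r, hC.1 i⟩ x := by
  have h : ∀ v, ∃ (w : V) (l : ℕ), ∀ i (hv : v ∈ (C i).verts), (v ≠ r → w = p i ⟨v, hv⟩) ∧
      l = (C i).coe.dist ⟨r, hC.1 i⟩ ⟨v, hv⟩ := by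
    intro v
    by_cases hv : v = r
    · subst hv
      exact ⟨v, 0, fun i _ => ⟨fun h => absurd rfl h, SimpleGraph.dist_self.symm⟩⟩
    · obtain ⟨i, hi⟩ := hC.exists_mem v
      refine ⟨p i ⟨v, hi⟩, (C i).coe.dist ⟨r, hC.1 i⟩ ⟨v, hi⟩, fun j hj => ?_⟩
      obtain rfl := hC.eq_of_mem hv hi hj
      exact ⟨fun _ => rfl, rfl⟩
  choose P lvl hPl using h
  have hP : ∀ i (x : (C i).verts), x.1 ≠ r → P x = p i x := fun i x => (hPl x i x.2).1
  have hl : ∀ i (x : (C i).verts), lvl x = (C i).coe.dist ⟨r, hC.1 i⟩ x := fun i x => (hPl x i x.2).2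
  refine ⟨P, lvl, ⟨fun a b => ?_, ?_, fun v hv => ?_⟩, hP, hl⟩
  · rw [hC.adj_iff]
    constructor
    · rintro ⟨i, hi⟩
      rcases ((hp i).adj_iff ⟨a, (C i).edge_vert hi⟩ ⟨b, (C i).edge_vert hi.symm⟩).1 hi with
        ⟨h1, h2⟩ | ⟨h1, h2⟩
      · have h1 : a ≠ r := fun h => h1 (Subtype.ext h)
        exact Or.inl ⟨h1, (hP i ⟨a, (C i).edge_vert hi⟩ h1).trans (congrArg _ h2)⟩
      · have h1 : b ≠ r := fun h => h1 (Subtype.ext h)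
        exact Or.inr ⟨h1, (hP i ⟨b, (C i).edge_vert hi.symm⟩ h1).trans (congrArg _ h2)⟩
    · have key : ∀ v, v ≠ r → ∃ i, (C i).Adj (P v) v := fun v hv => by
        obtain ⟨i, hi⟩ := hC.exists_mem v
        have := (hp i).adj_parent (v := ⟨v, hi⟩) fun h => hv (congrArg Subtype.val h)
        rw [SimpleGraph.Subgraph.coe_adj, ← hP i ⟨v, hi⟩ hv] at this
        exact ⟨i, this⟩
      rintro (⟨h1, rfl⟩ | ⟨h1, rfl⟩)
      · exact (key a h1).imp fun i h => h.symm
      · exact key b h1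
  · obtain ⟨i, hi⟩ := hC.exists_mem r
    rw [hl i ⟨r, hi⟩, SimpleGraph.dist_self]
  · obtain ⟨i, hi⟩ := hC.exists_mem v
    rw [hP i ⟨v, hi⟩ hv, hl i ⟨v, hi⟩, hl i (p i ⟨v, hi⟩)]
    exact (hp i).lvl_succ ⟨v, hi⟩ fun h => hv (congrArg Subtype.val h)

end

theorem IsArbitrarilyFixedGeneralizedBananaTree.isEvenCaterpillarBananaTree {V : Type*}
    [Fintype V] [Nontrivial V] {G : SimpleGraph V}
    (hG : IsArbitrarilyFixedGeneralizedBananaTree G) : IsEvenCaterpillarBananaTree G := by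
  obtain ⟨n, C, r, N, D, hC, hD, hcat⟩ := hG
  have hn : 0 < n := (hC.exists_mem r).choose.pos
  have hN : 0 < N := by
    rw [Nat.pos_iff_ne_zero]
    rintro rfl
    obtain ⟨v, hv⟩ := exists_ne r
    obtain ⟨i, hi⟩ := hC.exists_mem v
    have := SimpleGraph.subsingleton_of_ediam_eq_zero (hcat i).2.1
    exact hv (congrArg Subtype.val (Subsingleton.elim (⟨v, hi⟩ : (C i).verts) ⟨r, hC.1 i⟩))
  have hecc : ∀ i, (C i).coe.eccent ⟨r, hC.1 i⟩ = (N : ℕ∞) := by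
    intro i
    refine le_antisymm ?_ ?_
    · rw [← (hcat i).2.1]
      exact SimpleGraph.eccent_le_ediam
    · rw [← (hcat i).2.1]
      exact iSup_le ((hcat i).2.2 ⟨r, hC.1 i⟩ rfl).1
  choose U hU0 hUadj hUdist hUleaf using fun i =>
    (hcat i).1.exists_spine (hecc i) (hcat i).2.1
  choose p hp using fun i => exists_isRootedTree (hcat i).1.1 (⟨r, hC.1 i⟩ : (C i).verts)
  obtain ⟨P, lvl, T, hP, hlvl⟩ := hC.exists_isRootedTree hp
  -- The body is cut at level N - 1 = h + 1, the last level whose degrees are unconstrained. For N =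
  -- 1 truncation gives h = 0, and the body is all of the tree.
  obtain ⟨h, hh⟩ : ∃ h, h = N - 2 := ⟨_, rfl⟩
  let u : Fin n → ℕ → V := fun i l => U i l
  have hul : ∀ i, ∀ l ≤ N, lvl (u i l) = l := fun i l hl => by
    rw [hlvl i (U i l), hUdist i l hl]
  have hne : ∀ i, ∀ l < N, u i (l + 1) ≠ r := fun i l hl h => by
    have := hul i (l + 1) hl
    rw [h, T.lvl_root] at this
    omega
  have huadj : ∀ i, ∀ l < N, G.Adj (u i l) (u i (l + 1)) := fun i l hl =>
    (hC.adj_iff _ _).2 ⟨i, hUadj i l hl⟩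
  have hpar : ∀ i, ∀ l < N, P (u i (l + 1)) = u i l := fun i l hl =>
    (T.parent_eq (huadj i l hl) (by rw [hul i l hl.le, hul i (l + 1) hl])).2
  have hinj : ∀ i j l, 1 ≤ l → l ≤ N → u i l = u j l → i = j := by
    intro i j l h1 hl hij
    obtain ⟨k, rfl⟩ : ∃ k, l = k + 1 := ⟨l - 1, by omega⟩
    exact hC.eq_of_mem (hne i k hl) (U i (k + 1)).2 (hij ▸ (U j (k + 1)).2)
  have hleaf : ∀ x, (∀ i, ∀ l ≤ h + 1, x ≠ u i l) →
      ∃ i l, 1 ≤ l ∧ l + 1 ≤ N ∧ P x = u i l := by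
    intro x hx
    obtain ⟨i, hi⟩ := hC.exists_mem x
    by_cases hxU : ∀ l ≤ N, (⟨x, hi⟩ : (C i).verts) ≠ U i l
    · obtain ⟨l, h1, h2, h3, h4⟩ := hUleaf i ⟨x, hi⟩ hxU
      refine ⟨i, l, h1, h2, (T.parent_eq ((hC.adj_iff _ _).2 ⟨i, h3⟩) ?_).2⟩
      rw [hlvl i ⟨x, hi⟩, h4, hul i l (by omega)]
    · push Not at hxU
      obtain ⟨l, hl, hxl⟩ := hxU
      have hxl : x = u i l := congrArg Subtype.val hxl
      have h1 : h + 1 < l := by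
        by_contra hcon
        exact hx i l (by omega) hxl
      obtain ⟨k, rfl⟩ : ∃ k, l = k + 1 := ⟨l - 1, by omega⟩
      exact ⟨i, k, by omega, hl, by rw [hxl, hpar i k hl]⟩
  have S : IsSpider r P (h + 1) u :=
    { zero := fun i => congrArg Subtype.val (hU0 i)
      ne_root := fun i l hl => hne i l (by omega)
      parent := fun i l hl => hpar i l (by omega)
      inj := fun i j l h1 hl => hinj i j l h1 (by omega)
      leaf := fun x hx => by
        obtain ⟨i, l, h1, h2, h3⟩ := hleaf x hx
        exact ⟨i, l, by omega, h3⟩ }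
  refine S.isEvenCaterpillarBananaTree T hn (c := D - 2) ?_ ?_ ?_ ?_
  · rw [Nat.even_iff] at hD ⊢
    omega
  · rw [Finset.card_eq_zero, Finset.eq_empty_iff_forall_notMem]
    intro x hx
    obtain ⟨hx, hxr⟩ := mem_spiderLeaves.1 hx
    obtain ⟨i, l, h1, h2, h3⟩ := hleaf x hx
    obtain ⟨k, rfl⟩ : ∃ k, l = k + 1 := ⟨l - 1, by omega⟩
    exact hne i k (by omega) (h3.symm.trans hxr)
  · intro i l h1 hl
    classical
    obtain ⟨k, rfl⟩ : ∃ k, l = k + 1 := ⟨l - 1, by omega⟩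
    -- The neighbours are the two along the leg and the leaves, so the degree D leaves D - 2 leaves.
    have hset : Subtype.val '' (C i).coe.neighborSet (U i (k + 1)) =
        ((insert (u i k) (insert (u i (k + 2)) (spiderLeaves P (h + 1) u (u i (k + 1)))) :
          Finset V) : Set V) := by
      ext y
      have hG : y ∈ Subtype.val '' (C i).coe.neighborSet (U i (k + 1)) ↔
          G.Adj (u i (k + 1)) y := by
        rw [hC.adj_iff]
        constructor
        · rintro ⟨y, hy, rfl⟩
          exact ⟨i, hy⟩
        · rintro ⟨j, hj⟩
          obtain rfl := hC.eq_of_mem (hne i k (by omega)) (U i (k + 1)).2 ((C j).edge_vert hj)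
          exact ⟨⟨y, (C i).edge_vert hj.symm⟩, hj, rfl⟩
      rw [hG, T.adj_iff, hpar i k (by omega), Finset.mem_coe, Finset.mem_insert, Finset.mem_insert,
        mem_spiderLeaves]
      constructor
      · rintro (⟨-, rfl⟩ | ⟨hy, hPy⟩)
        · exact Or.inl rfl
        · right
          by_cases hcore : ∀ j, ∀ m ≤ h + 1, y ≠ u j m
          · exact Or.inr ⟨hcore, hPy⟩
          · left
            push Not at hcore
            obtain ⟨j, m, hm, rfl⟩ := hcore
            have h2 := T.lvl_succ _ hy
            rw [hPy, hul j m (by omega), hul i (k + 1) (by omega)] at h2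
            subst h2
            rw [hpar j (k + 1) (by omega)] at hPy
            rw [hinj j i (k + 1) (by omega) (by omega) hPy]
      · rintro (rfl | rfl | ⟨hy, hPy⟩)
        · exact Or.inl ⟨hne i k (by omega), rfl⟩
        · exact Or.inr ⟨hne i (k + 1) (by omega), hpar i (k + 1) (by omega)⟩
        · refine Or.inr ⟨fun hyr => hy i 0 (Nat.zero_le _) ?_, hPy⟩
          rw [hyr]
          exact (congrArg Subtype.val (hU0 i)).symm
    have hcard : ((C i).coe.neighborSet (U i (k + 1))).ncard =
        (spiderLeaves P (h + 1) u (u i (k + 1))).card + 2 := by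
      rw [← Set.ncard_image_of_injective _ Subtype.val_injective, hset, Set.ncard_coe_finset,
        Finset.card_insert_of_notMem, Finset.card_insert_of_notMem]
      · exact fun hmem => (mem_spiderLeaves.1 hmem).1 i (k + 2) (by omega) rfl
      · rw [Finset.mem_insert, not_or]
        refine ⟨fun heq => ?_, fun hmem => (mem_spiderLeaves.1 hmem).1 i k (by omega) rfl⟩
        have := congrArg lvl heq
        rw [hul i k (by omega), hul i (k + 2) (by omega)] at this
        omega
    have := ((hcat i).2.2 ⟨r, hC.1 i⟩ rfl).2 (U i (k + 1)) (by omega)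
      (by rw [hUdist i (k + 1) (by omega)]; omega)
    omega
  · rcases Nat.lt_or_ge N 2 with hN2 | hN2
    -- Here N = 1: the path has no internal vertex on which a leaf could hang.
    · refine Or.inr ⟨by omega, fun i => ?_⟩
      rw [Finset.card_eq_zero, Finset.eq_empty_iff_forall_notMem]
      intro x hx
      obtain ⟨j, l, h1, h2, -⟩ := hleaf x (mem_spiderLeaves.1 hx).1
      omega
    -- The last vertex of the longest path is itself a leaf at the end of the leg.
    · refine Or.inl fun i => Finset.card_pos.2 ⟨u i (h + 2), mem_spiderLeaves.2
        ⟨fun j m hm heq => ?_, hpar i (h + 1) (by omega)⟩⟩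
      have := congrArg lvl heq
      rw [hul i (h + 2) (by omega), hul j m (by omega)] at this
      omega

end GracefulTrees

theorem mainTheorem6 {V : Type*} [Fintype V] (G : SimpleGraph V) :
    (GracefulTrees.IsEvenCaterpillarBananaTree G → GracefulTrees.IsGraceful G) ∧
    (Nontrivial V →
      (GracefulTrees.IsBananaTree G → GracefulTrees.IsEvenCaterpillarBananaTree G) ∧
      (GracefulTrees.IsGeneralizedBananaTree G → GracefulTrees.IsEvenCaterpillarBananaTree G) ∧
      (GracefulTrees.IsArbitrarilyFixedGeneralizedBananaTree G →
        GracefulTrees.IsEvenCaterpillarBananaTree G)) := by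
  refine ⟨fun h => h.isGraceful, fun hV => ⟨fun h => ?_, fun h => ?_, fun h => ?_⟩⟩
  · exact h.isGeneralizedBananaTree.isEvenCaterpillarBananaTree
  · exact h.isEvenCaterpillarBananaTree
  · exact h.isEvenCaterpillarBananaTree
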